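/- A real function $f$ on $]0,\infty[$ is *completely monotonic* if it is $C^\infty$ and $(-1)^n f^{(n)}\ge 0$ on $]0,\infty[$ for every integer $n\ge 0$. Let $\mathfrak B$ be the set of *Bernstein functions*: the continuous non-negative functions $f:[0,\infty[\to\mathbb R$ that are differentiable on $]0,\infty[$ and whose derivative is completely monotonic and integrable over $[0,1]$. Let $\mathfrak F$ be the set of *complete Bernstein functions*: the continuous functions $f:[0,\infty[\to\mathbb R$ for which there is $g\in\mathfrak B$ with $f(x)=x^2\,\tilde g(x)$ for all $x>0$, where $\tilde g(x)=\int_0^\infty e^{-xt}g(t)\,dt$ is the Laplace transform of $g$. For a set $S$ of non-negative functions on $[0,\infty[$ and $\alpha,\beta>0$ put $S^{\alpha}=\{f^\alpha \mid f\in S\}$, and for any set $S$ of real functions on $[0,\infty[$ put $p^{\beta}S=\{p\mapsto p^{\beta}f(p)\mid f\in S\}$. Then $$\mathfrak F\cap p^{1/2}\,\mathfrak F \;=\; p^{1/2}\,\mathfrak F^{1/2}.$$ Moreover, the class $\mathcal K_{\mathfrak B}:=\mathfrak F\cap p^{1/2}\,\mathfrak F$ of wave-number functions for Bernstein creep compliances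 is contained in the class $\mathcal K_{\mathfrak Q}:=p^{1/2}\,\mathfrak B^{1/2}$ of wave-number functions for CrF (non-negative, non-decreasing and concave) creep compliances: $$\mathcal K_{\mathfrak B}\subset \mathcal K_{\mathfrak Q}.$$ -/

import Mathlib

open scoped NNReal ContDiff

noncomputable section

/-- A real function on `]0,∞[` is completely monotonic if it is `C^∞` there and
`(-1)^n D^n f ≥ 0` for every `n`. Only the values on `]0,∞[` matter. -/
def IsCompletelyMonotonic (f : ℝ → ℝ) : Prop :=
  ContDiffOn ℝ ∞ f (Set.Ioi 0) ∧
    ∀ (n : ℕ) (x : ℝ), 0 < x → 0 ≤ (-1) ^ n * iteratedDerivWithin n f (Set.Ioi 0) x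

/-- Locally integrable completely monotonic functions: completely monotonic functions
that are integrable over `[0,1]`. -/
def IsLICM (f : ℝ → ℝ) : Prop :=
  IsCompletelyMonotonic f ∧ MeasureTheory.IntegrableOn f (Set.Icc 0 1)

/-- A function on `[0,∞[`, viewed as a function on `ℝ` (constant on the negative half-line). -/
def extendHalfLine (f : ℝ≥0 → ℝ) : ℝ → ℝ := fun x => f x.toNNReal

/-- The class `𝔅` of Bernstein functions: non-negative continuous functions on `[0,∞[` which are
differentiable on `]0,∞[`, with a locally integrable completely monotonic derivative. -/
def bernsteinClass : Set (ℝ≥0 → ℝ) :=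
  {f | Continuous f ∧ (∀ x, 0 ≤ f x) ∧
    (∀ x : ℝ, 0 < x → DifferentiableAt ℝ (extendHalfLine f) x) ∧
    IsLICM (deriv (extendHalfLine f))}

/-- The Laplace transform `x ↦ ∫_0^∞ e^{-x t} g(t) dt` of a function on `[0,∞[`. For a Bernstein
function `g` the integral converges absolutely for all `x > 0`, as `g` grows at most linearly. -/
def laplaceTransform (g : ℝ≥0 → ℝ) (x : ℝ) : ℝ :=
  ∫ t in Set.Ioi (0 : ℝ), Real.exp (-(x * t)) * extendHalfLine g t

/-- The class `𝔉` of complete Bernstein functions: functions `f` on `[0,∞[` of the form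
`f(x) = x² g̃(x)` for `x > 0`, with `g` a Bernstein function. The value at the
end point `0` is the limit there, i.e. `f` is continuous on `[0,∞[`. -/
def completeBernsteinClass : Set (ℝ≥0 → ℝ) :=
  {f | Continuous f ∧ ∃ g ∈ bernsteinClass,
    ∀ x : ℝ≥0, 0 < x → f x = (x : ℝ) ^ 2 * laplaceTransform g x}

/-- `S^α = { f^α ∣ f ∈ S }`. -/
def powClass (S : Set (ℝ≥0 → ℝ)) (α : ℝ) : Set (ℝ≥0 → ℝ) :=
  (fun f p => f p ^ α) '' S

/-- `p^β S = { p ↦ p^β f(p) ∣ f ∈ S }`. -/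
def varPowMulClass (β : ℝ) (S : Set (ℝ≥0 → ℝ)) : Set (ℝ≥0 → ℝ) :=
  (fun f p => (p : ℝ) ^ β * f p) '' S

/-- The class `𝔉 ∩ p^{1/2} 𝔉` of wave-number functions for Bernstein creep compliances. -/
def waveNumberClassBernstein : Set (ℝ≥0 → ℝ) :=
  completeBernsteinClass ∩ varPowMulClass (1 / 2) completeBernsteinClass

/-- The class `p^{1/2} 𝔅^{1/2}` of wave-number functions for CrF (non-negative, non-decreasing and
concave) creep compliances. -/
def waveNumberClassCrF : Set (ℝ≥0 → ℝ) :=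
  varPowMulClass (1 / 2) (powClass bernsteinClass (1 / 2))

end

/-! Everything rests on one description of `completeBernsteinClass`: a continuous `f` belongs to it
exactly when, on the open half-line, it is a superposition of the kernels `x / ((1 - u) x + u)` over
a finite measure on the compact interval `[0,1]` (`mem_completeBernsteinClass_iff`). The endpoint `u
= 0` carries the constants and `u = 1` the linear functions. Compactness makes this class closed
under pointwise limits (`IsCBF.of_tendsto`), so approximate representations suffice everywhere.

To pass from the class to a measure, integrate by parts: `x² g̃(x) = x g(0) + x · L(g')(x)`, with
`L` the Laplace transform and `g'` completely monotonic. Taylor's formula with integral remainder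
approximates `g'` by positive combinations of exponentials `e^{-tl}`, and `x · L(e^{-tl}) = x / (x +
l)` is a kernel up to scaling. In the other direction, the measure gives an explicit completely
monotonic density, whose primitive is the required `g`.

The algebra takes place in the complex plane. The superposition extends to the slit plane and maps
the upper half-plane into its closure. Conversely, `IsPick.isCBF` recovers the representation from
this mapping property and mild growth conditions, by Cauchy's theorem in logarithmic coordinates.
Square roots halve arguments, so for `f` in the class both `√f` and `√(x f)` are again in it, which
is one inclusion. For the other, if `h` and `√x h` are in the class, then the extension of `h` has
values in the closed first quadrant over the upper half-plane; hence `h²` is in the class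
(`IsCBF.sq`) and `h = (h²)^{1/2}`.

The inclusion of the wave-number classes then follows from
`completeBernsteinClass_subset_bernsteinClass`. -/

open MeasureTheory Filter Topology Set

/-! ### Superpositions of the kernels over finite measures on the unit interval -/

/-- A function on `]0,∞[` is represented by a finite measure `σ` on `[0,1]` if it is the
superposition of the functions `x ↦ x / ((1 - u) x + u)`. -/
def IsCBF (f : ℝ → ℝ) : Prop :=
  ∃ σ : FiniteMeasure unitInterval,
    ∀ x : ℝ, 0 < x → f x =
      ∫ u : unitInterval, x / ((1 - (u : ℝ)) * x + u) ∂(σ : Measure unitInterval)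

theorem cbfKernel_denom_pos (u : unitInterval) {x : ℝ} (hx : 0 < x) :
    0 < (1 - (u : ℝ)) * x + u := by
  have h0 := u.2.1
  have h1 := u.2.2
  rcases h0.eq_or_lt with h | h
  · rw [← h]; simpa using hx
  · have := mul_nonneg (sub_nonneg.2 h1) hx.le
    linarith

theorem continuous_cbfKernel {x : ℝ} (hx : 0 < x) :
    Continuous fun u : unitInterval => x / ((1 - (u : ℝ)) * x + u) := by
  refine Continuous.div (by fun_prop) (by fun_prop) fun u => (cbfKernel_denom_pos u hx).ne'

theorem cbfKernel_nonneg (u : unitInterval) {x : ℝ} (hx : 0 < x) :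
    0 ≤ x / ((1 - (u : ℝ)) * x + u) :=
  div_nonneg hx.le (cbfKernel_denom_pos u hx).le

theorem integrable_cbfKernel (σ : FiniteMeasure unitInterval) {x : ℝ} (hx : 0 < x) :
    Integrable (fun u : unitInterval => x / ((1 - (u : ℝ)) * x + u))
      (σ : Measure unitInterval) := by
  have := (continuous_cbfKernel hx).integrable_of_hasCompactSupport
    (μ := (σ : Measure unitInterval)) (HasCompactSupport.of_compactSpace _)
  exact this

theorem IsCBF.nonneg {f : ℝ → ℝ} (hf : IsCBF f) {x : ℝ} (hx : 0 < x) : 0 ≤ f x := by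
  obtain ⟨σ, h⟩ := hf
  rw [h x hx]
  exact integral_nonneg fun u => cbfKernel_nonneg u hx

theorem IsCBF.congr {f g : ℝ → ℝ} (hf : IsCBF f) (h : ∀ x, 0 < x → g x = f x) : IsCBF g := by
  obtain ⟨σ, hσ⟩ := hf
  exact ⟨σ, fun x hx => (h x hx).trans (hσ x hx)⟩

/-- At `x = 1` every kernel equals `1`, so the mass of a representing measure is the value at `1`.
The masses are therefore eventually bounded, the measures have a weak cluster point by compactness,
and the kernels are continuous test functions. -/
theorem IsCBF.of_tendsto {ι : Type*} {l : Filter ι} [l.NeBot] {F : ι → ℝ → ℝ} {f : ℝ → ℝ}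
    (hF : ∀ᶠ i in l, IsCBF (F i)) (h : ∀ x, 0 < x → Tendsto (fun i => F i x) l (𝓝 (f x))) :
    IsCBF f := by
  classical
  let σ : ι → FiniteMeasure unitInterval := fun i =>
    if hi : IsCBF (F i) then hi.choose else 0
  have hσ : ∀ᶠ i in l, ∀ x : ℝ, 0 < x → F i x =
      ∫ u : unitInterval, x / ((1 - (u : ℝ)) * x + u) ∂(σ i : Measure unitInterval) := by
    filter_upwards [hF] with i hi
    simp only [σ, dif_pos hi]
    exact hi.choose_spec
  have hmass : ∀ᶠ i in l, σ i ∈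
      {μ : FiniteMeasure unitInterval | μ.mass ≤ (f 1 + 1).toNNReal} := by
    filter_upwards [hσ, (h 1 one_pos).eventually (gt_mem_nhds (lt_add_one (f 1)))] with i hi h1
    have e : F i 1 = (σ i).mass := by
      rw [hi 1 one_pos]
      have : ∀ u : unitInterval, (1 : ℝ) / ((1 - (u : ℝ)) * 1 + u) = 1 := by
        intro u; simp
      rw [integral_congr_ae (ae_of_all _ this), integral_const, smul_eq_mul, mul_one]
      rfl
    change (σ i).mass ≤ _; rw [← NNReal.coe_le_coe]
    refine le_trans ?_ (Real.le_coe_toNNReal _)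
    rw [← e]; exact h1.le
  obtain ⟨τ, -, hτ⟩ := (isCompact_setOfPred_finiteMeasure_le_of_compactSpace unitInterval
    (f 1 + 1).toNNReal).exists_mapClusterPt (le_principal_iff.2 hmass)
  refine ⟨τ, fun x hx => ?_⟩
  -- An ultrafilter finer than `l` turns the cluster point into a genuine limit.
  obtain ⟨U, hU, hUτ⟩ := mapClusterPt_iff_ultrafilter.1 hτ
  let k : BoundedContinuousFunction unitInterval ℝ :=
    BoundedContinuousFunction.mkOfCompact ⟨_, continuous_cbfKernel hx⟩
  have h1 := (FiniteMeasure.tendsto_iff_forall_integral_tendsto.1 hUτ) k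
  refine tendsto_nhds_unique ((h x hx).mono_left hU) (h1.congr' ?_)
  filter_upwards [hU hσ] with i hi
  exact (hi x hx).symm

theorem IsCBF.add {f g : ℝ → ℝ} (hf : IsCBF f) (hg : IsCBF g) : IsCBF fun x => f x + g x := by
  obtain ⟨σ, hσ⟩ := hf
  obtain ⟨τ, hτ⟩ := hg
  refine ⟨σ + τ, fun x hx => ?_⟩
  change f x + g x = _
  rw [hσ x hx, hτ x hx, FiniteMeasure.toMeasure_add,
    integral_add_measure (integrable_cbfKernel σ hx) (integrable_cbfKernel τ hx)]

/-- With `u = X / (1 + X)` one has `x / (x + X) = (1 + X)⁻¹ · x / ((1 - u) x + u)`, so the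
representing measure is the image of `w / (1 + X) · μ` under `u`. Replacing `X` by `max X 0` keeps
`u` in `[0,1]` on the null set where `X` is negative. -/
theorem isCBF_integral {Ω : Type*} [MeasurableSpace Ω] {μ : Measure Ω} {w X : Ω → ℝ}
    (hw : Integrable w μ) (hw0 : 0 ≤ᵐ[μ] w) (hX : Measurable X) (hX0 : 0 ≤ᵐ[μ] X) :
    IsCBF fun x => ∫ a, w a * (x / (x + X a)) ∂μ := by
  classical
  let U : Ω → unitInterval := fun a => ⟨max (X a) 0 / (1 + max (X a) 0), by positivity, by
    have : 0 ≤ max (X a) 0 := le_max_right _ _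
    rw [div_le_one (by positivity)]; linarith⟩
  have hU : Measurable U := by
    apply Measurable.subtype_mk; fun_prop
  let v : Ω → ENNReal := fun a => ENNReal.ofReal (w a / (1 + max (X a) 0))
  have hv : AEMeasurable v μ :=
    (hw.1.aemeasurable.div (by fun_prop)).ennreal_ofReal
  have hvlt : ∀ᵐ a ∂μ, v a < ⊤ := ae_of_all _ fun a => ENNReal.ofReal_lt_top
  have hint : Integrable (fun a => w a / (1 + max (X a) 0)) μ := by
    refine Integrable.mono hw (hw.1.aemeasurable.div (by fun_prop)).aestronglyMeasurable
      (ae_of_all _ fun a => ?_)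
    rw [norm_div]
    apply div_le_self (norm_nonneg _)
    have : 0 ≤ max (X a) 0 := le_max_right _ _
    rw [Real.norm_of_nonneg (by positivity)]; linarith
  have : IsFiniteMeasure (μ.withDensity v) := isFiniteMeasure_withDensity_ofReal hint.2
  refine ⟨⟨(μ.withDensity v).map U, inferInstance⟩, fun x hx => ?_⟩
  simp only [FiniteMeasure.toMeasure_mk]
  rw [integral_map hU.aemeasurable (continuous_cbfKernel hx).aestronglyMeasurable,
    integral_withDensity_eq_integral_toReal_smul₀ hv hvlt]
  refine integral_congr_ae ?_
  filter_upwards [hw0, hX0] with a h1 h2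
  simp only [Pi.zero_apply] at h1 h2
  simp only [v, U, max_eq_left h2, smul_eq_mul]
  rw [ENNReal.toReal_ofReal (by positivity)]
  have e : (1 - X a / (1 + X a)) * x + X a / (1 + X a) = (x + X a) / (1 + X a) := by
    field_simp; ring
  rw [e]
  field_simp

theorem isCBF_const {c : ℝ} (hc : 0 ≤ c) : IsCBF fun _ => c := by
  have := isCBF_integral (μ := Measure.dirac ()) (w := fun _ => c) (X := fun _ => 0)
    (integrable_const c) (ae_of_all _ fun _ => hc) measurable_const (ae_of_all _ fun _ => le_rfl)
  refine this.congr fun x hx => ?_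
  simp [hx.ne']

theorem isCBF_const_mul_id {c : ℝ} (hc : 0 ≤ c) : IsCBF fun x => c * x := by
  refine ⟨⟨ENNReal.ofReal c • Measure.dirac 1, ⟨by simp⟩⟩, fun x hx => ?_⟩
  simp only [FiniteMeasure.toMeasure_mk]
  rw [integral_smul_measure, integral_dirac]
  simp [hc]

/-! ### Analytic extension to the slit plane -/

/-- The sector of those `z ≠ 0` whose argument has cosine at least `-κ`. -/
def sector (κ : ℝ) : Set ℂ := {z | z ≠ 0 ∧ -κ * ‖z‖ ≤ z.re}

theorem sector_subset_slitPlane {κ : ℝ} (hκ : κ < 1) : sector κ ⊆ Complex.slitPlane := by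
  rintro z ⟨h0, h⟩
  by_contra hz
  rw [Complex.mem_slitPlane_iff, not_or, not_lt, not_not] at hz
  have h1 : ‖z‖ = -z.re := by
    rw [← Complex.abs_re_eq_norm.2 hz.2, abs_of_nonpos hz.1]
  have h2 : 0 < ‖z‖ := norm_pos_iff.2 h0
  nlinarith

/-- The analytic extension of `x ↦ ∫ x / ((1 - u) x + u) ∂σ` to the slit plane. -/
noncomputable def cbfExt (σ : FiniteMeasure unitInterval) (z : ℂ) : ℂ :=
  ∫ u : unitInterval, z / ((1 - ((u : ℝ) : ℂ)) * z + (u : ℝ)) ∂(σ : Measure unitInterval)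

/-- Write `a = 1 - u`, `b = u`, `r = ‖z‖`. Then `|az + b|² ≥ a²r² + b² - 2κabr`, and the right side
exceeds `(1 - κ)/2 · (ar + b)²` by `(1 + κ)/2 · (ar - b)²`. -/
theorem norm_cbfDenom_ge {κ : ℝ} (hκ0 : 0 ≤ κ) (hκ : κ < 1) {z : ℂ} (hz : -κ * ‖z‖ ≤ z.re)
    (u : unitInterval) :
    √((1 - κ) / 2) * ((1 - (u : ℝ)) * ‖z‖ + u) ≤ ‖(1 - ((u : ℝ) : ℂ)) * z + (u : ℝ)‖ := by
  have h0 := u.2.1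
  have h1 : 0 ≤ 1 - (u : ℝ) := sub_nonneg.2 u.2.2
  refine le_of_pow_le_pow_left₀ two_ne_zero (norm_nonneg _) ?_
  rw [mul_pow, Real.sq_sqrt (by linarith), ← Complex.normSq_eq_norm_sq]
  have hn : ‖z‖ ^ 2 = z.re ^ 2 + z.im ^ 2 := by
    rw [← Complex.normSq_eq_norm_sq, Complex.normSq_apply]; ring
  have e : Complex.normSq ((1 - ((u : ℝ) : ℂ)) * z + (u : ℝ)) =
      ((1 - (u : ℝ)) * ‖z‖) ^ 2 + u ^ 2 + 2 * ((1 - (u : ℝ)) * u) * z.re := by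
    rw [mul_pow, hn, Complex.normSq_apply]
    simp
    ring
  rw [e]
  have h2 := mul_le_mul_of_nonneg_left hz (mul_nonneg h1 h0)
  nlinarith [mul_nonneg (by linarith : (0 : ℝ) ≤ 1 + κ)
    (sq_nonneg ((1 - (u : ℝ)) * ‖z‖ - u))]

theorem cbfDenom_ne_zero {z : ℂ} (hz : z ∈ Complex.slitPlane) (u : unitInterval) :
    (1 - ((u : ℝ) : ℂ)) * z + (u : ℝ) ≠ 0 := by
  intro h
  have hre := congrArg Complex.re h
  have him := congrArg Complex.im h
  simp at hre him
  rcases him with h1 | h1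
  · have : (u : ℝ) = 1 := by linarith
    rw [this] at hre; simp at hre
  · rw [Complex.mem_slitPlane_iff] at hz
    have hz' : 0 < z.re := by tauto
    exact (cbfKernel_denom_pos u hz').ne' hre

theorem continuous_cbfKernel_complex {z : ℂ} (hz : z ∈ Complex.slitPlane) :
    Continuous fun u : unitInterval => z / ((1 - ((u : ℝ) : ℂ)) * z + (u : ℝ)) :=
  Continuous.div (by fun_prop) (by fun_prop) (cbfDenom_ne_zero hz)

theorem integrable_cbfKernel_complex (σ : FiniteMeasure unitInterval) {z : ℂ}
    (hz : z ∈ Complex.slitPlane) :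
    Integrable (fun u : unitInterval => z / ((1 - ((u : ℝ) : ℂ)) * z + (u : ℝ)))
      (σ : Measure unitInterval) :=
  (continuous_cbfKernel_complex hz).integrable_of_hasCompactSupport
    (HasCompactSupport.of_compactSpace _)

theorem cbfExt_ofReal (σ : FiniteMeasure unitInterval) (x : ℝ) :
    cbfExt σ x = ((∫ u : unitInterval, x / ((1 - (u : ℝ)) * x + u) ∂(σ : Measure unitInterval) :
      ℝ) : ℂ) := by
  rw [cbfExt, ← integral_complex_ofReal]
  refine integral_congr_ae (ae_of_all _ fun u => ?_)
  push_cast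
  rfl

theorem cbfExt_conj (σ : FiniteMeasure unitInterval) (z : ℂ) :
    cbfExt σ (starRingEnd ℂ z) = starRingEnd ℂ (cbfExt σ z) := by
  rw [cbfExt, cbfExt, ← integral_conj]
  refine integral_congr_ae (ae_of_all _ fun u => ?_)
  simp

/-- The values of `cbfExt σ` at `z` lie in the convex cone spanned by `1` and `z`. -/
theorem cbfExt_mem_cone (σ : FiniteMeasure unitInterval) {z : ℂ} (hz : z ∈ Complex.slitPlane)
    (L : ℂ →L[ℝ] ℝ) (h1 : 0 ≤ L 1) (h2 : 0 ≤ L z) : 0 ≤ L (cbfExt σ z) := by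
  rw [cbfExt, ← L.integral_comp_comm (integrable_cbfKernel_complex σ hz)]
  refine integral_nonneg fun u => ?_
  set D : ℂ := (1 - ((u : ℝ) : ℂ)) * z + (u : ℝ) with hD
  have hD0 : D ≠ 0 := cbfDenom_ne_zero hz u
  have hN : 0 < Complex.normSq D := Complex.normSq_pos.2 hD0
  -- The numerator of `z / D` after multiplication by `conj D` is `(1 - u)‖z‖² + u z`, a combination
  -- of `1` and `z` with non-negative coefficients.
  have e : z / D = (((1 - (u : ℝ)) * Complex.normSq z / Complex.normSq D : ℝ)) • (1 : ℂ) +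
      ((u : ℝ) / Complex.normSq D : ℝ) • z := by
    have hz' : (Complex.normSq z : ℂ) = z * starRingEnd ℂ z := (Complex.mul_conj z).symm
    have hD' : (Complex.normSq D : ℂ) = D * starRingEnd ℂ D := (Complex.mul_conj D).symm
    have hc : starRingEnd ℂ D ≠ 0 := (map_ne_zero _).2 hD0
    have hcD : starRingEnd ℂ D = (1 - ((u : ℝ) : ℂ)) * starRingEnd ℂ z + (u : ℝ) := by
      simp [hD]
    simp only [Complex.real_smul]
    push_cast
    rw [hz', hD']
    field_simp
    rw [hcD]
  change 0 ≤ L (z / D)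
  rw [e, map_add, map_smul, map_smul, smul_eq_mul, smul_eq_mul]
  have := u.2.1
  have := sub_nonneg.2 u.2.2
  have := Complex.normSq_nonneg z
  positivity

theorem cbfExt_im_nonneg (σ : FiniteMeasure unitInterval) {z : ℂ} (hz : 0 < z.im) :
    0 ≤ (cbfExt σ z).im :=
  cbfExt_mem_cone σ (Complex.mem_slitPlane_iff.2 (Or.inr hz.ne')) Complex.imCLM (by simp)
    (by simpa using hz.le)

theorem norm_cbfKernel_le {κ : ℝ} (hκ0 : 0 ≤ κ) (hκ : κ < 1) {z : ℂ} (hz : z ∈ sector κ)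
    (u : unitInterval) : ‖z / ((1 - ((u : ℝ) : ℂ)) * z + (u : ℝ))‖ ≤
      (√((1 - κ) / 2))⁻¹ * (‖z‖ / ((1 - (u : ℝ)) * ‖z‖ + u)) := by
  have h0 : 0 < ‖z‖ := norm_pos_iff.2 hz.1
  have h1 := cbfKernel_denom_pos u h0
  have h2 : 0 < √((1 - κ) / 2) := Real.sqrt_pos.2 (by linarith)
  rw [norm_div, inv_mul_eq_div, div_div, div_le_div_iff_of_pos_left h0
    (norm_pos_iff.2 (cbfDenom_ne_zero (sector_subset_slitPlane hκ hz) u)) (by positivity),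
    mul_comm]
  exact norm_cbfDenom_ge hκ0 hκ hz.2 u

theorem norm_cbfExt_le (σ : FiniteMeasure unitInterval) {κ : ℝ} (hκ0 : 0 ≤ κ) (hκ : κ < 1)
    {z : ℂ} (hz : z ∈ sector κ) : ‖cbfExt σ z‖ ≤ (√((1 - κ) / 2))⁻¹ *
      ∫ u : unitInterval, ‖z‖ / ((1 - (u : ℝ)) * ‖z‖ + u) ∂(σ : Measure unitInterval) := by
  rw [← integral_const_mul]
  exact norm_integral_le_of_norm_le
    ((integrable_cbfKernel σ (norm_pos_iff.2 hz.1)).const_mul _)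
    (ae_of_all _ fun u => norm_cbfKernel_le hκ0 hκ hz u)

theorem cbfKernel_le (u : unitInterval) {x : ℝ} (hx : 0 < x) :
    x / ((1 - (u : ℝ)) * x + u) ≤ max 1 x := by
  have h0 := u.2.1
  have h1 : 0 ≤ 1 - (u : ℝ) := sub_nonneg.2 u.2.2
  rw [div_le_iff₀ (cbfKernel_denom_pos u hx)]
  rcases le_total 1 x with h | h
  · rw [max_eq_right h]; nlinarith [mul_nonneg h1 (sub_nonneg.2 h)]
  · rw [max_eq_left h]; nlinarith [mul_nonneg h0 (sub_nonneg.2 h)]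

theorem IsCBF.exists_le_max {f : ℝ → ℝ} (hf : IsCBF f) :
    ∃ M, 0 ≤ M ∧ ∀ x, 0 < x → f x ≤ M * max 1 x := by
  obtain ⟨σ, h⟩ := hf
  refine ⟨(σ : Measure unitInterval).real univ, measureReal_nonneg, fun x hx => ?_⟩
  rw [h x hx, ← smul_eq_mul, ← integral_const]
  exact integral_mono (integrable_cbfKernel σ hx) (integrable_const _)
    fun u => cbfKernel_le u hx

/-- As `z → 0` the kernel tends to `0` for `u ≠ 0` and is constantly `1` for `u = 0`, so only the
atom at `0` survives. The sector supplies the constant that dominates. -/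
theorem cbfExt_tendsto (σ : FiniteMeasure unitInterval) {κ : ℝ} (hκ0 : 0 ≤ κ) (hκ : κ < 1) :
    Tendsto (cbfExt σ) (𝓝[sector κ] 0)
      (𝓝 (((σ : Measure unitInterval).real {0} : ℝ) : ℂ)) := by
  have e : (((σ : Measure unitInterval).real {0} : ℝ) : ℂ) =
      ∫ u : unitInterval, Set.indicator {0} (fun _ => (1 : ℂ)) u ∂(σ : Measure unitInterval) := by
    rw [integral_indicator_const _ (measurableSet_singleton _)]
    simp
  rw [e]
  have hs : ∀ᶠ z in 𝓝[sector κ] (0 : ℂ), z ∈ sector κ := self_mem_nhdsWithin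
  refine tendsto_integral_filter_of_dominated_convergence
    (fun _ => (√((1 - κ) / 2))⁻¹) ?_ ?_ (integrable_const _) (ae_of_all _ fun u => ?_)
  · filter_upwards [hs] with z hz
    exact (continuous_cbfKernel_complex (sector_subset_slitPlane hκ hz)).aestronglyMeasurable
  · have hb : ∀ᶠ z in 𝓝[sector κ] (0 : ℂ), ‖z‖ < 1 := by
      refine nhdsWithin_le_nhds ?_
      filter_upwards [Metric.ball_mem_nhds (0 : ℂ) one_pos] with z hz
      simpa using hz
    filter_upwards [hs, hb] with z hz hz1
    refine ae_of_all _ fun u => (norm_cbfKernel_le hκ0 hκ hz u).trans ?_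
    have := cbfKernel_le u (norm_pos_iff.2 hz.1)
    rw [max_eq_left hz1.le] at this
    exact mul_le_of_le_one_right (by positivity) this
  · by_cases hu : u = 0
    · subst hu
      simp only [mem_singleton_iff, indicator_of_mem]
      refine tendsto_const_nhds.congr' ?_
      filter_upwards [hs] with z hz
      simp [hz.1]
    · have : u ∉ ({0} : Set unitInterval) := hu
      rw [indicator_of_notMem this]
      refine Tendsto.mono_left ?_ nhdsWithin_le_nhds
      have hu' : ((u : ℝ) : ℂ) ≠ 0 := by
        intro h; apply hu; ext; simpa using h
      have : ContinuousAt (fun z : ℂ => z / ((1 - ((u : ℝ) : ℂ)) * z + (u : ℝ))) 0 := by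
        refine ContinuousAt.div continuousAt_id (by fun_prop) (by simpa using hu')
      simpa [ContinuousAt] using this

theorem hasDerivAt_cbfExt (σ : FiniteMeasure unitInterval) {z : ℂ} (hz : z ∈ Complex.slitPlane) :
    HasDerivAt (cbfExt σ) (∫ u : unitInterval,
      ((u : ℝ) : ℂ) / ((1 - ((u : ℝ) : ℂ)) * z + (u : ℝ)) ^ 2 ∂(σ : Measure unitInterval)) z := by
  have hz0 : 0 < ‖z‖ := norm_pos_iff.2 (Complex.slitPlane_ne_zero hz)
  have hre : -‖z‖ < z.re := by
    rcases (abs_le.1 (Complex.abs_re_le_norm z)).1.lt_or_eq with h | h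
    · exact h
    · have : |z.re| = ‖z‖ := by rw [← h, abs_neg, abs_norm]
      rw [Complex.abs_re_eq_norm] at this
      rcases Complex.mem_slitPlane_iff.1 hz with h' | h'
      · linarith
      · exact absurd this h'
  -- The strict inequality places a whole neighbourhood of `z` in one sector, where the denominators
  -- are uniformly bounded below.
  obtain ⟨κ, hκ0, hκ, hzκ⟩ : ∃ κ : ℝ, 0 ≤ κ ∧ κ < 1 ∧ -κ * ‖z‖ < z.re := by
    obtain ⟨κ, h1, h2⟩ := exists_between (show max 0 (-z.re / ‖z‖) < 1 by
      rw [max_lt_iff, div_lt_one hz0]; exact ⟨one_pos, by linarith⟩)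
    refine ⟨κ, (le_max_left _ _).trans h1.le, h2, ?_⟩
    have := (le_max_right _ _).trans_lt h1
    rw [div_lt_iff₀ hz0] at this
    linarith
  let S : Set ℂ := {w | -κ * ‖w‖ < w.re} ∩ {w | ‖z‖ / 2 < ‖w‖}
  have hS : S ∈ 𝓝 z := by
    refine IsOpen.mem_nhds (IsOpen.inter ?_ ?_) ⟨hzκ, by simpa using hz0⟩
    · exact isOpen_lt (by fun_prop) (by fun_prop)
    · exact isOpen_lt (by fun_prop) (by fun_prop)
  have hSsec : ∀ w ∈ S, w ∈ sector κ := fun w hw => by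
    refine ⟨?_, hw.1.le⟩
    rw [← norm_pos_iff]
    have := hw.2
    simp only [mem_ofPred_eq] at this
    linarith
  have hSslit : ∀ w ∈ S, w ∈ Complex.slitPlane := fun w hw =>
    sector_subset_slitPlane hκ (hSsec w hw)
  set δ := min 1 (‖z‖ / 2) with hδ
  have hδ0 : 0 < δ := lt_min one_pos (by linarith)
  have hc : 0 < √((1 - κ) / 2) := Real.sqrt_pos.2 (by linarith)
  refine (hasDerivAt_integral_of_dominated_loc_of_deriv_le (𝕜 := ℂ) (s := S)
    (F := fun z (u : unitInterval) => z / ((1 - ((u : ℝ) : ℂ)) * z + (u : ℝ)))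
    (F' := fun z (u : unitInterval) =>
      ((u : ℝ) : ℂ) / ((1 - ((u : ℝ) : ℂ)) * z + (u : ℝ)) ^ 2)
    (bound := fun _ => ((√((1 - κ) / 2) * δ) ^ 2)⁻¹) hS ?_
    (integrable_cbfKernel_complex σ hz) ?_ ?_ (integrable_const _) ?_).2
  · filter_upwards [hS] with w hw
    exact (continuous_cbfKernel_complex (hSslit w hw)).aestronglyMeasurable
  · refine (Continuous.div (by fun_prop) (by fun_prop) fun u => ?_).aestronglyMeasurable
    exact pow_ne_zero _ (cbfDenom_ne_zero hz u)
  · refine ae_of_all _ fun u w hw => ?_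
    have h1 := norm_cbfDenom_ge hκ0 hκ (hSsec w hw).2 u
    have h2 : δ ≤ (1 - (u : ℝ)) * ‖w‖ + u := by
      have h3 : δ ≤ ‖w‖ := (min_le_right _ _).trans hw.2.le
      have h4 : δ ≤ 1 := min_le_left _ _
      nlinarith [mul_le_mul_of_nonneg_left h3 (sub_nonneg.2 u.2.2),
        mul_le_mul_of_nonneg_left h4 u.2.1]
    rw [norm_div, norm_pow]
    have h5 : ‖((u : ℝ) : ℂ)‖ ≤ 1 := by
      rw [Complex.norm_real, Real.norm_of_nonneg u.2.1]; exact u.2.2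
    rw [← one_div]
    gcongr
    exact (mul_le_mul_of_nonneg_left h2 hc.le).trans h1
  · refine ae_of_all _ fun u w hw => ?_
    have hD := cbfDenom_ne_zero (hSslit w hw) u
    have := (hasDerivAt_id w).div
      (((hasDerivAt_id w).const_mul (1 - ((u : ℝ) : ℂ))).add_const ((u : ℝ) : ℂ)) hD
    refine this.congr_deriv ?_
    simp only [id]
    congr 1
    ring

theorem differentiableOn_cbfExt (σ : FiniteMeasure unitInterval) :
    DifferentiableOn ℂ (cbfExt σ) Complex.slitPlane := fun _ hz =>
  (hasDerivAt_cbfExt σ hz).differentiableAt.differentiableWithinAt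

/-! ### Pick functions and their integral representation by Cauchy's theorem -/

/-- Holomorphic functions on the slit plane that are real on the positive half-line, map the upper
half-plane to its closure, grow at most linearly in sectors and have a non-negative limit at `0`
in sectors. -/
structure IsPick (F : ℂ → ℂ) : Prop where
  differentiableOn : DifferentiableOn ℂ F Complex.slitPlane
  map_conj : ∀ z ∈ Complex.slitPlane, F (starRingEnd ℂ z) = starRingEnd ℂ (F z)
  im_nonneg : ∀ z : ℂ, 0 < z.im → 0 ≤ (F z).im
  norm_le : ∀ κ : ℝ, 0 ≤ κ → κ < 1 → ∃ C : ℝ, 0 ≤ C ∧ ∀ z ∈ sector κ, ‖F z‖ ≤ C * (1 + ‖z‖)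
  tendsto : ∃ b : ℝ, 0 ≤ b ∧ ∀ κ : ℝ, 0 ≤ κ → κ < 1 → Tendsto F (𝓝[sector κ] 0) (𝓝 (b : ℂ))

theorem ofReal_mem_slitPlane {x : ℝ} (hx : 0 < x) : (x : ℂ) ∈ Complex.slitPlane := by
  rw [Complex.mem_slitPlane_iff]; left; simpa using hx

theorem exp_mem_slitPlane {w : ℂ} (hw : |w.im| < Real.pi) : Complex.exp w ∈ Complex.slitPlane := by
  have h := abs_lt.1 hw
  rw [Complex.mem_slitPlane_iff_arg]
  refine ⟨?_, Complex.exp_ne_zero w⟩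
  rw [Complex.arg_exp, (toIocMod_eq_self Real.two_pi_pos).2 ⟨h.1, by linarith [h.2]⟩]
  exact h.2.ne

/-- The factor `α` shrinks arguments to at most `απ`. For `α < 1` the closed strip is thus mapped
into one fixed sector away from the cut, and no boundary values of a Pick function on the cut are
needed. -/
theorem exp_mem_sector {α : ℝ} (h0 : 0 ≤ α) (h1 : α ≤ 1) {w : ℂ} (hw : |w.im| ≤ Real.pi) :
    Complex.exp (α * w) ∈ sector (max 0 (-Real.cos (α * Real.pi))) := by
  refine ⟨Complex.exp_ne_zero _, ?_⟩
  have h2 : Real.cos (α * Real.pi) ≤ Real.cos (α * w.im) := by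
    rw [← Real.cos_abs (α * w.im), abs_mul, abs_of_nonneg h0]
    exact Real.cos_le_cos_of_nonneg_of_le_pi (by positivity)
      (mul_le_of_le_one_left Real.pi_pos.le h1) (by gcongr)
  rw [Complex.norm_exp, Complex.exp_re]
  have h3 : ((α : ℂ) * w).re = α * w.re := by simp
  have h4 : ((α : ℂ) * w).im = α * w.im := by simp
  rw [h3, h4, mul_comm]
  have := le_max_right 0 (-Real.cos (α * Real.pi))
  gcongr
  linarith

theorem max_neg_cos_lt_one {α : ℝ} (h0 : 0 ≤ α) (h1 : α < 1) :
    max 0 (-Real.cos (α * Real.pi)) < 1 := by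
  rw [max_lt_iff]
  refine ⟨one_pos, ?_⟩
  have : Real.cos Real.pi < Real.cos (α * Real.pi) :=
    Real.cos_lt_cos_of_nonneg_of_le_pi (by positivity) le_rfl
      (mul_lt_of_lt_one_left Real.pi_pos h1)
  rw [Real.cos_pi] at this
  linarith

/-- The difference quotient to which the Cauchy theorem is applied. -/
noncomputable def expSlope (G : ℂ → ℂ) (c : ℂ) (w : ℂ) : ℂ :=
  dslope G c w / dslope Complex.exp c w

theorem expSlope_of_ne {G : ℂ → ℂ} {c w : ℂ} (h : w ≠ c) :
    expSlope G c w = (G w - G c) / (Complex.exp w - Complex.exp c) := by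
  rw [expSlope, dslope_of_ne _ h, dslope_of_ne _ h, slope_def_field, slope_def_field]
  rw [div_div_div_cancel_right₀ (sub_ne_zero.2 h)]

/-- Solutions of `e^w = e^x` differ from `x` by multiples of `2πi`, and only `w = x` lies in the
closed strip; there the derivative is `e^x`. -/
theorem dslope_exp_ne_zero {x : ℝ} {w : ℂ} (hw : |w.im| ≤ Real.pi) :
    dslope Complex.exp (x : ℂ) w ≠ 0 := by
  by_cases h : w = x
  · rw [h, dslope_same]
    simp
  · rw [dslope_of_ne _ h, slope_def_field]
    refine div_ne_zero ?_ (sub_ne_zero.2 h)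
    rw [sub_ne_zero]
    intro he
    have h1 := congrArg Complex.im he
    have h2 := congrArg Complex.re he
    obtain ⟨n, hn⟩ := Complex.exp_eq_exp_iff_exists_int.1 he
    have hre := congrArg Complex.re hn
    have him := congrArg Complex.im hn
    simp at hre him
    have h3 := abs_le.1 hw
    have hpi := Real.pi_pos
    have hn0 : n = 0 := by
      rw [him] at h3
      have a1 : (-1 : ℝ) < n := by nlinarith
      have a2 : (n : ℝ) < 1 := by nlinarith
      have a1' : -1 < n := by exact_mod_cast a1
      have a2' : n < 1 := by exact_mod_cast a2
      omega
    apply h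
    rw [hn, hn0]; simp

/-- Since `α < 1`, the composite with `exp (α w)` is holomorphic on the open strip `|Im w| < π/α`,
which contains the closed one; the singularity at `x` is removable. -/
theorem IsPick.expSlope_differentiableOn {F : ℂ → ℂ} (hF : IsPick F) {α : ℝ} (h0 : 0 < α)
    (h1 : α < 1) (x : ℝ) :
    DifferentiableOn ℂ (expSlope (fun w => F (Complex.exp (α * w))) x)
      {w : ℂ | |w.im| ≤ Real.pi} := by
  let s : Set ℂ := {w : ℂ | |w.im| < Real.pi / α}
  have hs : IsOpen s := isOpen_lt (by fun_prop) (by fun_prop)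
  have hsub : {w : ℂ | |w.im| ≤ Real.pi} ⊆ s := fun w hw => by
    refine lt_of_le_of_lt (show |w.im| ≤ Real.pi from hw) ?_
    rw [lt_div_iff₀ h0]
    exact mul_lt_of_lt_one_right Real.pi_pos h1
  have hx : s ∈ 𝓝 (x : ℂ) := hs.mem_nhds (by
    change |(x : ℂ).im| < Real.pi / α
    simp only [Complex.ofReal_im, abs_zero]; exact div_pos Real.pi_pos h0)
  have hG : DifferentiableOn ℂ (fun w => F (Complex.exp (α * w))) s := by
    refine hF.differentiableOn.comp (by fun_prop) fun w hw => exp_mem_slitPlane ?_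
    have hw' : |w.im| < Real.pi / α := hw
    rw [lt_div_iff₀ h0] at hw'
    simp only [Complex.mul_im, Complex.ofReal_re, Complex.ofReal_im, zero_mul, add_zero, abs_mul,
      abs_of_pos h0]
    linarith
  refine DifferentiableOn.div ?_ ?_ fun w hw => dslope_exp_ne_zero hw
  · exact ((Complex.differentiableOn_dslope hx).2 hG).mono hsub
  · exact ((Complex.differentiableOn_dslope hx).2 Complex.differentiable_exp.differentiableOn).mono
      hsub

theorem exp_ofReal_log {x : ℝ} (hx : 0 < x) : Complex.exp ((Real.log x : ℝ) : ℂ) = x := by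
  rw [← Complex.ofReal_exp, Real.exp_log hx]

theorem exp_mul_log {x : ℝ} (hx : 0 < x) (α : ℝ) :
    Complex.exp (α * (Real.log x : ℝ)) = ((x ^ α : ℝ) : ℂ) := by
  rw [← Complex.ofReal_mul, ← Complex.ofReal_exp, Real.rpow_def_of_pos hx, mul_comm]

theorem ofReal_add_mul_I_ne {a b y : ℝ} (h : a ≠ b) : (a : ℂ) + y * Complex.I ≠ (b : ℂ) := by
  intro he
  have := congrArg Complex.re he
  simp at this
  exact h this

theorem norm_exp_mul_ofReal_add (α R y : ℝ) :
    ‖Complex.exp (α * ((R : ℂ) + y * Complex.I))‖ = Real.exp (α * R) := by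
  rw [Complex.norm_exp]; simp

theorem norm_exp_ofReal_add (R y : ℝ) :
    ‖Complex.exp ((R : ℂ) + y * Complex.I)‖ = Real.exp R := by
  rw [Complex.norm_exp]; simp

theorem tendsto_quotient_exp {α : ℝ} (h1 : α < 1) (C V x : ℝ) :
    Tendsto (fun R : ℝ => (C * (1 + Real.exp (α * R)) + V) / (Real.exp R - x)) atTop (𝓝 0) := by
  have e1 : Tendsto (fun R : ℝ => Real.exp (-R)) atTop (𝓝 0) :=
    Real.tendsto_exp_neg_atTop_nhds_zero
  have e2 : Tendsto (fun R : ℝ => Real.exp (-((1 - α) * R))) atTop (𝓝 0) :=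
    e1.comp (tendsto_id.const_mul_atTop (by linarith : 0 < 1 - α))
  have h := (((e1.const_mul (C + V)).add (e2.const_mul C)).div
    ((tendsto_const_nhds (x := (1 : ℝ))).sub (e1.const_mul x)) (by simp))
  simp only [mul_zero, add_zero, sub_zero, zero_div] at h
  refine h.congr fun R => ?_
  have e3 : Real.exp (α * R) = Real.exp R * Real.exp (-((1 - α) * R)) := by
    rw [← Real.exp_add]; congr 1; ring
  have e4 : Real.exp R * Real.exp (-R) = 1 := by rw [← Real.exp_add]; simp
  have e5 := Real.exp_pos R
  simp only [Pi.div_apply]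
  rw [← mul_div_mul_left _ _ e5.ne', e3]
  congr 1
  · linear_combination (C + V) * e4
  · linear_combination -x * e4

section

variable {F : ℂ → ℂ} {α x : ℝ}

theorem IsPick.continuous_expSlope_vertical (hF : IsPick F) (h0 : 0 < α) (h1 : α < 1) (c R : ℝ) :
    ContinuousOn (fun y : ℝ => expSlope (fun w => F (Complex.exp (α * w))) c (R + y * Complex.I))
      (uIcc (-Real.pi) Real.pi) := by
  refine (hF.expSlope_differentiableOn h0 h1 c).continuousOn.comp (by fun_prop) fun y hy => ?_
  rw [uIcc_of_le (by linarith [Real.pi_pos])] at hy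
  simpa [abs_le] using hy

/-- Linear growth of `F` in a sector gives a numerator `O(e^{αR})` against a denominator of size
`e^R`. -/
theorem IsPick.tendsto_right (hF : IsPick F) (h0 : 0 < α) (h1 : α < 1) (hx : 0 < x) :
    Tendsto (fun R : ℝ => ∫ y in -Real.pi..Real.pi,
      expSlope (fun w => F (Complex.exp (α * w))) (Real.log x : ℝ) (R + y * Complex.I))
      atTop (𝓝 0) := by
  obtain ⟨C, hC0, hC⟩ := hF.norm_le _ (le_max_left _ _) (max_neg_cos_lt_one h0.le h1)
  have hpi := Real.pi_pos
  set V : ℝ := ‖F (Complex.exp (α * (Real.log x : ℝ)))‖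
  have ht := (tendsto_quotient_exp h1 C V x).mul_const (|Real.pi - -Real.pi|)
  rw [zero_mul] at ht
  refine squeeze_zero_norm' ?_ ht
  filter_upwards [eventually_gt_atTop (Real.log x)] with R hR
  refine intervalIntegral.norm_integral_le_of_norm_le_const fun y hy => ?_
  rw [uIoc_of_le (by linarith)] at hy
  have hy' : |y| ≤ Real.pi := abs_le.2 ⟨hy.1.le, hy.2⟩
  have hlt : x < Real.exp R := (Real.log_lt_iff_lt_exp hx).1 hR
  rw [expSlope_of_ne (ofReal_add_mul_I_ne hR.ne'), exp_ofReal_log hx, norm_div]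
  have n1 : ‖F (Complex.exp (α * (R + y * Complex.I)))‖ ≤ C * (1 + Real.exp (α * R)) := by
    have := hC _ (exp_mem_sector h0.le h1.le (w := (R : ℂ) + y * Complex.I) (by simpa using hy'))
    rwa [norm_exp_mul_ofReal_add] at this
  have n2 : Real.exp R - x ≤ ‖Complex.exp (R + y * Complex.I) - x‖ := by
    have := norm_sub_norm_le (Complex.exp (R + y * Complex.I)) (x : ℂ)
    rwa [norm_exp_ofReal_add, Complex.norm_real, Real.norm_of_nonneg hx.le] at this
  have n3 : 0 < Real.exp R - x := by linarith
  gcongr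
  exact (norm_sub_le _ _).trans (by gcongr)

/-- On the left edge `e^w` and `e^{αw}` tend to `0`, the latter within a sector, so the integrand
tends to `(b - F(x^α)) / (0 - x)` on an edge of length `2π`. -/
theorem IsPick.tendsto_left (hF : IsPick F) (h0 : 0 < α) (h1 : α < 1) (hx : 0 < x) {b : ℂ}
    (hb : ∀ κ : ℝ, 0 ≤ κ → κ < 1 → Tendsto F (𝓝[sector κ] 0) (𝓝 b)) :
    Tendsto (fun R : ℝ => ∫ y in -Real.pi..Real.pi,
      expSlope (fun w => F (Complex.exp (α * w))) (Real.log x : ℝ) ((-R : ℝ) + y * Complex.I))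
      atTop (𝓝 (2 * Real.pi * ((F ((x ^ α : ℝ) : ℂ) - b) / x))) := by
  obtain ⟨C, hC0, hC⟩ := hF.norm_le _ (le_max_left _ _) (max_neg_cos_lt_one h0.le h1)
  have hpi := Real.pi_pos
  have hxc : (x : ℂ) ≠ 0 := by exact_mod_cast hx.ne'
  set V : ℝ := ‖F ((x ^ α : ℝ) : ℂ)‖ with hV
  have e : 2 * Real.pi * ((F ((x ^ α : ℝ) : ℂ) - b) / x) =
      ∫ _ in -Real.pi..Real.pi, (b - F ((x ^ α : ℝ) : ℂ)) / (0 - x) := by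
    rw [intervalIntegral.integral_const, Complex.real_smul]
    push_cast
    field_simp
    ring
  have hexp : Tendsto (fun R : ℝ => Real.exp (-R)) atTop (𝓝 0) :=
    Real.tendsto_exp_neg_atTop_nhds_zero
  have hev : ∀ᶠ R : ℝ in atTop, 0 ≤ R ∧ Real.exp (-R) < x / 2 :=
    (eventually_ge_atTop 0).and (hexp.eventually (gt_mem_nhds (by linarith)))
  have hne : ∀ R : ℝ, Real.exp (-R) < x / 2 → -R ≠ Real.log x := fun R h he => by
    rw [he, Real.exp_log hx] at h; linarith
  rw [e]
  refine intervalIntegral.tendsto_integral_filter_of_dominated_convergence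
    (fun _ => (2 * C + V) / (x / 2)) ?_ ?_ intervalIntegrable_const ?_
  · refine Eventually.of_forall fun R => ?_
    refine ContinuousOn.aestronglyMeasurable ?_ measurableSet_uIoc
    exact (hF.continuous_expSlope_vertical h0 h1 _ (-R)).mono uIoc_subset_uIcc
  · filter_upwards [hev] with R hR
    refine ae_of_all _ fun y hy => ?_
    rw [uIoc_of_le (by linarith)] at hy
    have hy' : |y| ≤ Real.pi := abs_le.2 ⟨hy.1.le, hy.2⟩
    rw [expSlope_of_ne (ofReal_add_mul_I_ne (hne R hR.2)), exp_ofReal_log hx, norm_div,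
      exp_mul_log hx]
    have n1 : ‖F (Complex.exp (α * ((-R : ℝ) + y * Complex.I)))‖ ≤ 2 * C := by
      have := hC _ (exp_mem_sector h0.le h1.le (w := ((-R : ℝ) : ℂ) + y * Complex.I)
        (by simpa using hy'))
      rw [norm_exp_mul_ofReal_add] at this
      have h3 : Real.exp (α * -R) ≤ 1 := Real.exp_le_one_iff.2 (by nlinarith [hR.1])
      nlinarith
    have n2 : x / 2 ≤ ‖Complex.exp ((-R : ℝ) + y * Complex.I) - x‖ := by
      have := norm_sub_norm_le (x : ℂ) (Complex.exp ((-R : ℝ) + y * Complex.I))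
      rw [norm_exp_ofReal_add, Complex.norm_real, Real.norm_of_nonneg hx.le, norm_sub_rev] at this
      linarith [hR.2]
    gcongr
    exact (norm_sub_le _ _).trans (by gcongr)
  · refine ae_of_all _ fun y hy => ?_
    rw [uIoc_of_le (by linarith)] at hy
    have hy' : |y| ≤ Real.pi := abs_le.2 ⟨hy.1.le, hy.2⟩
    have t1 : Tendsto (fun R : ℝ => Complex.exp (α * ((-R : ℝ) + y * Complex.I))) atTop
        (𝓝[sector (max 0 (-Real.cos (α * Real.pi)))] 0) := by
      refine tendsto_nhdsWithin_iff.2 ⟨?_, Eventually.of_forall fun R =>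
        exp_mem_sector h0.le h1.le (by simpa using hy')⟩
      rw [tendsto_zero_iff_norm_tendsto_zero]
      simp only [norm_exp_mul_ofReal_add]
      have := hexp.comp (tendsto_id.const_mul_atTop h0)
      refine this.congr fun R => ?_
      simp
    have t2 := (hb _ (le_max_left _ _) (max_neg_cos_lt_one h0.le h1)).comp t1
    have t3 : Tendsto (fun R : ℝ => Complex.exp ((-R : ℝ) + y * Complex.I)) atTop (𝓝 0) := by
      rw [tendsto_zero_iff_norm_tendsto_zero]
      simpa only [norm_exp_ofReal_add] using hexp
    have t4 := (t2.sub_const (F ((x ^ α : ℝ) : ℂ))).div (t3.sub_const (x : ℂ)) (by simpa using hxc)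
    refine t4.congr' ?_
    filter_upwards [hev] with R hR
    rw [expSlope_of_ne (ofReal_add_mul_I_ne (hne R hR.2)), exp_ofReal_log hx, exp_mul_log hx]
    rfl

theorem exp_ofReal_add_pi_mul_I (r : ℝ) :
    Complex.exp (r + Real.pi * Complex.I) = -(Real.exp r : ℂ) := by
  rw [Complex.exp_add, Complex.exp_pi_mul_I, Complex.ofReal_exp]; ring

theorem exp_ofReal_add_neg_pi_mul_I (r : ℝ) :
    Complex.exp (r + (-Real.pi : ℝ) * Complex.I) = -(Real.exp r : ℂ) := by
  have : (r : ℂ) + (-Real.pi : ℝ) * Complex.I = (r + Real.pi * Complex.I) - 2 * Real.pi * Complex.I := by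
    push_cast; ring
  rw [this, Complex.exp_periodic.sub_eq, exp_ofReal_add_pi_mul_I]

theorem IsPick.continuous_boundary (hF : IsPick F) (h0 : 0 < α) (h1 : α < 1) {θ : ℝ}
    (hθ : |θ| ≤ Real.pi) :
    Continuous fun r : ℝ => F (Complex.exp (α * (r + θ * Complex.I))) := by
  refine hF.differentiableOn.continuousOn.comp_continuous (by fun_prop) fun r => ?_
  refine exp_mem_slitPlane ?_
  simp only [Complex.mul_im, Complex.add_im, Complex.ofReal_im, Complex.I_im, Complex.ofReal_re,
    mul_one, Complex.I_re, mul_zero, zero_mul, add_zero, zero_add, abs_mul, abs_of_pos h0]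
  nlinarith [Real.pi_pos]

/-- On both horizontal edges `e^w = -e^r`. The denominators agree, the subtracted constant cancels,
and conjugation symmetry leaves `2i` times an imaginary part. -/
theorem IsPick.expSlope_sub (hF : IsPick F) (h0 : 0 < α) (h1 : α < 1) (hx : 0 < x) (r : ℝ) :
    expSlope (fun w => F (Complex.exp (α * w))) (Real.log x : ℝ) (r + (-Real.pi : ℝ) * Complex.I) -
      expSlope (fun w => F (Complex.exp (α * w))) (Real.log x : ℝ) (r + Real.pi * Complex.I) =
    2 * Complex.I * ((F (Complex.exp (α * (r + Real.pi * Complex.I)))).im / (x + Real.exp r) : ℝ)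
      := by
  have hne : ∀ θ : ℝ, θ ≠ 0 → (r : ℂ) + θ * Complex.I ≠ (Real.log x : ℝ) := fun θ hθ he => by
    have := congrArg Complex.im he
    simp at this
    exact hθ this
  have hpi := Real.pi_pos
  rw [expSlope_of_ne (hne _ (by linarith)), expSlope_of_ne (hne _ hpi.ne'), exp_ofReal_log hx,
    exp_ofReal_add_pi_mul_I, exp_ofReal_add_neg_pi_mul_I]
  have hmem : Complex.exp (α * (r + Real.pi * Complex.I)) ∈ Complex.slitPlane := by
    refine exp_mem_slitPlane ?_
    simp only [Complex.mul_im, Complex.add_im, Complex.ofReal_im, Complex.I_im, Complex.ofReal_re,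
      mul_one, Complex.I_re, mul_zero, zero_mul, add_zero, zero_add, abs_mul, abs_of_pos h0,
      abs_of_pos hpi]
    nlinarith
  have hc : Complex.exp (α * (r + (-Real.pi : ℝ) * Complex.I)) =
      starRingEnd ℂ (Complex.exp (α * (r + Real.pi * Complex.I))) := by
    rw [← Complex.exp_conj]; simp
  rw [hc, hF.map_conj _ hmem]
  set v := F (Complex.exp (α * (r + Real.pi * Complex.I)))
  have hd : ((x : ℂ) + Real.exp r) ≠ 0 := by
    have : 0 < x + Real.exp r := by positivity
    exact_mod_cast this.ne'
  have hd' : (-(Real.exp r : ℂ) - x) = -(x + Real.exp r) := by ring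
  have hv := Complex.sub_conj v
  rw [hd', ← sub_div]
  push_cast at hv hd ⊢
  rw [div_neg, eq_comm, mul_div_assoc', ← neg_div]
  congr 1
  linear_combination -hv

/-- Cauchy's theorem on the rectangle `[-R, R] × [-π, π]`: the horizontal edges yield the integral,
the left edge yields `F(x^α) - b` in the limit, and the right edge vanishes. -/
theorem IsPick.tendsto_cauchy (hF : IsPick F) (h0 : 0 < α) (h1 : α < 1) (hx : 0 < x) {b : ℝ}
    (hb : ∀ κ : ℝ, 0 ≤ κ → κ < 1 → Tendsto F (𝓝[sector κ] 0) (𝓝 (b : ℂ))) :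
    Tendsto (fun R : ℝ => b + ∫ r in -R..R,
      (Real.pi⁻¹ * (F (Complex.exp (α * (r + Real.pi * Complex.I)))).im) * (x / (x + Real.exp r)))
      atTop (𝓝 (F ((x ^ α : ℝ) : ℂ)).re) := by
  have hpi := Real.pi_pos
  have hxc : (x : ℂ) ≠ 0 := by exact_mod_cast hx.ne'
  have hpic : (Real.pi : ℂ) ≠ 0 := by exact_mod_cast hpi.ne'
  set T := expSlope (fun w => F (Complex.exp (α * w))) (Real.log x : ℝ) with hT
  set J : ℝ → ℝ := fun R => ∫ r in -R..R,
    (F (Complex.exp (α * (r + Real.pi * Complex.I)))).im / (x + Real.exp r) with hJ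
  have key : ∀ R : ℝ, 2 * (J R : ℂ) =
      (∫ y in -Real.pi..Real.pi, T ((-R : ℝ) + y * Complex.I)) -
        ∫ y in -Real.pi..Real.pi, T (R + y * Complex.I) := by
    intro R
    have hdiff := hF.expSlope_differentiableOn h0 h1 (Real.log x)
    have hc := Complex.integral_boundary_rect_eq_zero_of_differentiableOn T
      (⟨-R, -Real.pi⟩ : ℂ) (⟨R, Real.pi⟩ : ℂ) (hdiff.mono fun w hw => by
        have := hw.2
        simp only [mem_preimage] at this
        rw [uIcc_of_le (by linarith)] at this
        exact abs_le.2 this)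
    simp only [smul_eq_mul] at hc
    have hint : ∀ θ : ℝ, |θ| ≤ Real.pi →
        IntervalIntegrable (fun r : ℝ => T (r + θ * Complex.I)) volume (-R) R := fun θ hθ => by
      refine (Continuous.intervalIntegrable ?_ _ _)
      exact hdiff.continuousOn.comp_continuous (by fun_prop) fun r => by simpa using hθ
    rw [← intervalIntegral.integral_sub
      (hint _ (by rw [abs_neg, abs_of_pos hpi])) (hint _ (abs_of_pos hpi).le)] at hc
    simp only [hT, hF.expSlope_sub h0 h1 hx] at hc
    rw [intervalIntegral.integral_const_mul, intervalIntegral.integral_ofReal] at hc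
    rw [hJ]
    have hI : Complex.I ≠ 0 := Complex.I_ne_zero
    apply mul_left_cancel₀ hI
    linear_combination hc
  have hlim := ((hF.tendsto_left h0 h1 hx hb).sub (hF.tendsto_right h0 h1 hx)).congr
    fun R => (key R).symm
  have h2 : Tendsto (fun R => (b : ℂ) + x / Real.pi * (J R : ℂ)) atTop
      (𝓝 (F ((x ^ α : ℝ) : ℂ))) := by
    have := (hlim.const_mul ((x : ℂ) / (2 * Real.pi))).const_add (b : ℂ)
    convert this using 2
    · ring
    · rw [sub_zero]
      field_simp
      ring
  have h3 := (Complex.continuous_re.tendsto _).comp h2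
  refine h3.congr fun R => ?_
  simp only [Function.comp_apply]
  rw [← Complex.ofReal_div, ← Complex.ofReal_mul, ← Complex.ofReal_add, Complex.ofReal_re, hJ]
  rw [← intervalIntegral.integral_const_mul]
  congr 1
  refine intervalIntegral.integral_congr fun r _ => ?_
  field_simp

/-- Each truncated integral has a non-negative density because `0 < απ < π` places the boundary
points in the upper half-plane. Closure under limits removes the truncation without a convergence
estimate for the density. -/
theorem IsPick.isCBF_rpow (hF : IsPick F) (h0 : 0 < α) (h1 : α < 1) :
    IsCBF fun x => (F ((x ^ α : ℝ) : ℂ)).re := by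
  obtain ⟨b, hb0, hb⟩ := hF.tendsto
  have hpi := Real.pi_pos
  refine IsCBF.of_tendsto (l := atTop) (Eventually.mono (eventually_ge_atTop (0 : ℝ)) ?_)
    fun x hx => hF.tendsto_cauchy h0 h1 hx hb
  intro R hR
  refine (isCBF_const hb0).add ?_
  simp only [intervalIntegral.integral_of_le (by linarith : -R ≤ R)]
  refine isCBF_integral ?_ (ae_of_all _ fun r => ?_) Real.measurable_exp
    (ae_of_all _ fun r => (Real.exp_pos r).le)
  · refine (Continuous.integrableOn_Ioc ?_)
    exact continuous_const.mul (Complex.continuous_im.comp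
      (hF.continuous_boundary h0 h1 (abs_of_pos hpi).le))
  · refine mul_nonneg (inv_nonneg.2 hpi.le) (hF.im_nonneg _ ?_)
    rw [Complex.exp_im]
    simp only [Complex.mul_im, Complex.add_im, Complex.ofReal_im, Complex.I_im, Complex.ofReal_re,
      mul_one, Complex.I_re, mul_zero, zero_mul, add_zero, zero_add]
    exact mul_pos (Real.exp_pos _) (Real.sin_pos_of_pos_of_lt_pi (by positivity) (by nlinarith))

theorem IsPick.isCBF (hF : IsPick F) : IsCBF fun x => (F (x : ℂ)).re := by
  -- The denominator is `n + 2` so that the exponent is positive already for `n = 0`.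
  have hα : Tendsto (fun n : ℕ => 1 - 1 / ((n : ℝ) + 1 + 1)) atTop (𝓝 (1 - 0)) :=
    (((tendsto_add_atTop_iff_nat 1).2 tendsto_one_div_add_atTop_nhds_zero_nat).congr
      (by intro n; push_cast; rfl)).const_sub 1
  rw [sub_zero] at hα
  refine IsCBF.of_tendsto (l := atTop) (Eventually.of_forall fun n : ℕ =>
    hF.isCBF_rpow (α := 1 - 1 / ((n : ℝ) + 1 + 1)) ?_ ?_) fun x hx => ?_
  · rw [sub_pos, div_lt_one (by positivity)]; linarith [Nat.cast_nonneg (α := ℝ) n]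
  · rw [sub_lt_self_iff]; positivity
  · have h1 : Tendsto (fun n : ℕ => x ^ (1 - 1 / ((n : ℝ) + 1 + 1))) atTop (𝓝 x) := by
      have := ((Real.continuous_const_rpow hx.ne').tendsto 1).comp hα
      rwa [Real.rpow_one] at this
    have h2 : ContinuousAt F x := (hF.differentiableOn.differentiableAt
      (Complex.isOpen_slitPlane.mem_nhds (ofReal_mem_slitPlane hx))).continuousAt
    exact (Complex.continuous_re.tendsto _).comp
      (h2.tendsto.comp ((Complex.continuous_ofReal.tendsto _).comp h1))

end

/-! ### Square roots and squares of Pick functions -/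

/-- The principal square root on `ℂ`. -/
noncomputable def csqrt (z : ℂ) : ℂ := z ^ ((1 / 2 : ℝ) : ℂ)

theorem csqrt_re_nonneg (z : ℂ) : 0 ≤ (csqrt z).re := by
  rw [csqrt, Complex.cpow_ofReal_re]
  have h1 := Complex.neg_pi_lt_arg z
  have h2 := Complex.arg_le_pi z
  exact mul_nonneg (by positivity)
    (Real.cos_nonneg_of_neg_pi_div_two_le_of_le (by linarith) (by linarith))

theorem csqrt_im_nonneg {z : ℂ} (hz : 0 ≤ z.im) : 0 ≤ (csqrt z).im := by
  rw [csqrt, Complex.cpow_ofReal_im]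
  have h1 := Complex.arg_nonneg_iff.2 hz
  have h2 := Complex.arg_le_pi z
  exact mul_nonneg (by positivity) (Real.sin_nonneg_of_nonneg_of_le_pi (by linarith) (by linarith))

theorem csqrt_mul_self (z : ℂ) : csqrt z * csqrt z = z := by
  have : ((1 / 2 : ℝ) : ℂ) = ((2 : ℕ) : ℂ)⁻¹ := by push_cast; norm_num
  rw [← sq, csqrt, this]
  exact Complex.cpow_nat_inv_pow z two_ne_zero

theorem csqrt_conj {z : ℂ} (hz : z ∈ Complex.slitPlane) :
    csqrt (starRingEnd ℂ z) = starRingEnd ℂ (csqrt z) := by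
  rw [csqrt, csqrt, Complex.conj_cpow _ _ (Complex.mem_slitPlane_iff_arg.1 hz).1,
    Complex.conj_ofReal]

theorem norm_csqrt (z : ℂ) : ‖csqrt z‖ = ‖z‖ ^ (1 / 2 : ℝ) := Complex.norm_cpow_real _ _

theorem csqrt_ofReal {x : ℝ} (hx : 0 ≤ x) : csqrt x = ((x ^ (1 / 2 : ℝ) : ℝ) : ℂ) :=
  (Complex.ofReal_cpow hx _).symm

theorem continuousAt_csqrt_ofReal {b : ℝ} (hb : 0 ≤ b) : ContinuousAt csqrt (b : ℂ) :=
  Complex.continuousAt_cpow_const_of_re_pos (Or.inl (by simpa using hb))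
    (by rw [Complex.ofReal_re]; norm_num)

theorem differentiableOn_csqrt_comp {F : ℂ → ℂ} {s : Set ℂ} (hF : DifferentiableOn ℂ F s)
    (h : ∀ z ∈ s, F z ∈ Complex.slitPlane) : DifferentiableOn ℂ (fun z => csqrt (F z)) s :=
  hF.cpow_const h

theorem rpow_half_le_one_add {t : ℝ} (ht : 0 ≤ t) : t ^ (1 / 2 : ℝ) ≤ 1 + t := by
  rw [← Real.sqrt_eq_rpow, Real.sqrt_le_left (by positivity)]
  nlinarith

theorem isPick_cbfExt (σ : FiniteMeasure unitInterval) : IsPick (cbfExt σ) where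
  differentiableOn := differentiableOn_cbfExt σ
  map_conj z _ := cbfExt_conj σ z
  im_nonneg z hz := cbfExt_im_nonneg σ hz
  norm_le κ h0 h1 := by
    obtain ⟨M, hM0, hM⟩ := IsCBF.exists_le_max ⟨σ, fun x _ => rfl⟩
    refine ⟨(√((1 - κ) / 2))⁻¹ * M, by positivity, fun z hz => ?_⟩
    refine (norm_cbfExt_le σ h0 h1 hz).trans ?_
    rw [mul_assoc]
    refine mul_le_mul_of_nonneg_left ((hM _ (norm_pos_iff.2 hz.1)).trans ?_) (by positivity)
    exact mul_le_mul_of_nonneg_left (max_le (by simp) (by simp)) hM0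
  tendsto := ⟨_, measureReal_nonneg, fun _ h0 h1 => cbfExt_tendsto σ h0 h1⟩

theorem IsPick.nonneg {F : ℂ → ℂ} (hF : IsPick F) {x : ℝ} (hx : 0 < x) : 0 ≤ (F x).re :=
  hF.isCBF.nonneg hx

theorem IsPick.add_const_mul_id {F : ℂ → ℂ} (hF : IsPick F) {ε : ℝ} (hε : 0 ≤ ε) :
    IsPick fun z => F z + ε * z where
  differentiableOn := hF.differentiableOn.add (by fun_prop)
  map_conj z hz := by simp [hF.map_conj z hz]
  im_nonneg z hz := by
    have := hF.im_nonneg z hz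
    simp only [Complex.add_im, Complex.mul_im, Complex.ofReal_re, Complex.ofReal_im, zero_mul,
      add_zero]
    positivity
  norm_le κ h0 h1 := by
    obtain ⟨C, hC0, hC⟩ := hF.norm_le κ h0 h1
    refine ⟨C + ε, by positivity, fun z hz => (norm_add_le _ _).trans ?_⟩
    have := hC z hz
    rw [norm_mul, Complex.norm_real, Real.norm_of_nonneg hε]
    nlinarith
  tendsto := by
    obtain ⟨b, hb0, hb⟩ := hF.tendsto
    refine ⟨b, hb0, fun κ h0 h1 => ?_⟩
    have h2 : Tendsto (fun z : ℂ => (ε : ℂ) * z) (𝓝[sector κ] 0) (𝓝 0) := by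
      have : ContinuousAt (fun z : ℂ => (ε : ℂ) * z) 0 := by fun_prop
      simpa [ContinuousAt] using this.tendsto.mono_left nhdsWithin_le_nhds
    simpa using (hb κ h0 h1).add h2

/-- `F` itself may vanish or take negative values; adding `ε z` makes the imaginary part strictly of
the sign of `Im z`, and the value on the positive half-line strictly positive. Thus the principal
square root stays holomorphic along it. -/
theorem IsPick.add_mem_slitPlane {F : ℂ → ℂ} (hF : IsPick F) {ε : ℝ} (hε : 0 < ε) {z : ℂ}
    (hz : z ∈ Complex.slitPlane) : F z + ε * z ∈ Complex.slitPlane := by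
  rw [Complex.mem_slitPlane_iff]
  rcases lt_trichotomy z.im 0 with h | h | h
  · right
    have h1 := hF.im_nonneg (starRingEnd ℂ z) (by simpa using h)
    rw [hF.map_conj z hz] at h1
    simp at h1 ⊢
    nlinarith
  · left
    have hre : 0 < z.re := by
      rcases Complex.mem_slitPlane_iff.1 hz with h' | h'
      · exact h'
      · exact absurd h h'
    have e : z = (z.re : ℂ) := Complex.ext rfl (by simpa using h)
    rw [e]
    have := hF.nonneg hre
    simp
    positivity
  · right
    have h1 := hF.im_nonneg z h
    simp
    positivity

theorem IsPick.csqrt {F : ℂ → ℂ} (hF : IsPick F)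
    (hs : ∀ z ∈ Complex.slitPlane, F z ∈ Complex.slitPlane) : IsPick fun z => csqrt (F z) where
  differentiableOn := differentiableOn_csqrt_comp hF.differentiableOn hs
  map_conj z hz := by rw [hF.map_conj z hz, csqrt_conj (hs z hz)]
  im_nonneg z hz := csqrt_im_nonneg (hF.im_nonneg z hz)
  norm_le κ h0 h1 := by
    obtain ⟨C, hC0, hC⟩ := hF.norm_le κ h0 h1
    refine ⟨1 + C, by positivity, fun z hz => ?_⟩
    rw [norm_csqrt]
    refine (rpow_half_le_one_add (norm_nonneg _)).trans ?_
    nlinarith [hC z hz, norm_nonneg z]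
  tendsto := by
    obtain ⟨b, hb0, hb⟩ := hF.tendsto
    refine ⟨b ^ (1 / 2 : ℝ), by positivity, fun κ h0 h1 => ?_⟩
    rw [← csqrt_ofReal hb0]
    exact (continuousAt_csqrt_ofReal hb0).tendsto.comp (hb κ h0 h1)

/-- Over the upper half-plane both roots lie in the closed first quadrant, so their product has
non-negative imaginary part; `√(‖z‖ ‖F z‖)` still grows at most linearly. -/
theorem IsPick.csqrt_mul_csqrt {F : ℂ → ℂ} (hF : IsPick F)
    (hs : ∀ z ∈ Complex.slitPlane, F z ∈ Complex.slitPlane) :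
    IsPick fun z => _root_.csqrt z * _root_.csqrt (F z) where
  differentiableOn := (differentiableOn_csqrt_comp differentiableOn_id fun _ h => h).mul
    (hF.csqrt hs).differentiableOn
  map_conj z hz := by rw [csqrt_conj hz, (hF.csqrt hs).map_conj z hz, map_mul]
  im_nonneg z hz := by
    rw [Complex.mul_im]
    exact add_nonneg (mul_nonneg (csqrt_re_nonneg _) (csqrt_im_nonneg (hF.im_nonneg z hz)))
      (mul_nonneg (csqrt_im_nonneg hz.le) (csqrt_re_nonneg _))
  norm_le κ h0 h1 := by
    obtain ⟨C, hC0, hC⟩ := hF.norm_le κ h0 h1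
    refine ⟨1 + C, by positivity, fun z hz => ?_⟩
    rw [norm_mul, norm_csqrt, norm_csqrt, ← Real.mul_rpow (norm_nonneg _) (norm_nonneg _),
      ← Real.sqrt_eq_rpow, Real.sqrt_le_left (by positivity)]
    have h2 := hC z hz
    have h3 := norm_nonneg z
    calc ‖z‖ * ‖F z‖ ≤ (1 + ‖z‖) * (C * (1 + ‖z‖)) := by gcongr; linarith
      _ = C * (1 + ‖z‖) ^ 2 := by ring
      _ ≤ (1 + C) ^ 2 * (1 + ‖z‖) ^ 2 := by gcongr; nlinarith
      _ = _ := by ring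
  tendsto := by
    obtain ⟨b, hb0, hb⟩ := (hF.csqrt hs).tendsto
    refine ⟨0, le_rfl, fun κ h0 h1 => ?_⟩
    have h2 : Tendsto _root_.csqrt (𝓝[sector κ] 0) (𝓝 0) := by
      have := (continuousAt_csqrt_ofReal le_rfl).tendsto
      rw [csqrt_ofReal le_rfl] at this
      simp at this
      exact this.mono_left nhdsWithin_le_nhds
    simpa using h2.mul (hb κ h0 h1)

theorem tendsto_add_const_mul_nhdsGT (a x : ℝ) :
    Tendsto (fun ε : ℝ => a + ε * x) (𝓝[>] 0) (𝓝 a) := by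
  have : ContinuousAt (fun ε : ℝ => a + ε * x) 0 := by fun_prop
  simpa [ContinuousAt] using this.tendsto.mono_left nhdsWithin_le_nhds

theorem IsCBF.sqrt {f : ℝ → ℝ} (hf : IsCBF f) : IsCBF fun x => f x ^ (1 / 2 : ℝ) := by
  have hf' := hf
  obtain ⟨σ, h⟩ := hf
  have hp := isPick_cbfExt σ
  refine IsCBF.of_tendsto (l := 𝓝[>] (0 : ℝ)) (F := fun ε x => (f x + ε * x) ^ (1 / 2 : ℝ)) ?_
    fun x hx => ?_
  · filter_upwards [self_mem_nhdsWithin] with ε hε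
    have hε0 : 0 < ε := hε
    refine ((hp.add_const_mul_id hε0.le).csqrt fun z => hp.add_mem_slitPlane hε0).isCBF.congr
      fun x hx => ?_
    have := hf'.nonneg hx
    rw [cbfExt_ofReal, ← h x hx, ← Complex.ofReal_mul, ← Complex.ofReal_add,
      csqrt_ofReal (by positivity), Complex.ofReal_re]
  · exact (Real.continuous_rpow_const (by norm_num)).continuousAt.tendsto.comp
      (tendsto_add_const_mul_nhdsGT _ _)

theorem IsCBF.sqrt_mul {f : ℝ → ℝ} (hf : IsCBF f) :
    IsCBF fun x => x ^ (1 / 2 : ℝ) * f x ^ (1 / 2 : ℝ) := by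
  have hf' := hf
  obtain ⟨σ, h⟩ := hf
  have hp := isPick_cbfExt σ
  refine IsCBF.of_tendsto (l := 𝓝[>] (0 : ℝ))
    (F := fun ε x => x ^ (1 / 2 : ℝ) * (f x + ε * x) ^ (1 / 2 : ℝ)) ?_ fun x hx => ?_
  · filter_upwards [self_mem_nhdsWithin] with ε hε
    have hε0 : 0 < ε := hε
    refine ((hp.add_const_mul_id hε0.le).csqrt_mul_csqrt
      fun z => hp.add_mem_slitPlane hε0).isCBF.congr fun x hx => ?_
    have := hf'.nonneg hx
    rw [cbfExt_ofReal, ← h x hx, ← Complex.ofReal_mul, ← Complex.ofReal_add,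
      csqrt_ofReal hx.le, csqrt_ofReal (by positivity), ← Complex.ofReal_mul, Complex.ofReal_re]
  · exact ((Real.continuous_rpow_const (by norm_num)).continuousAt.tendsto.comp
      (tendsto_add_const_mul_nhdsGT _ _)).const_mul _

/-- Identity theorem on the connected slit plane, applied along real points tending to `1`. -/
theorem cbfExt_eq_csqrt_mul {σ τ : FiniteMeasure unitInterval}
    (h : ∀ x : ℝ, 0 < x → cbfExt τ x = csqrt x * cbfExt σ x) {z : ℂ}
    (hz : z ∈ Complex.slitPlane) : cbfExt τ z = csqrt z * cbfExt σ z := by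
  have hd : DifferentiableOn ℂ (fun z => csqrt z * cbfExt σ z) Complex.slitPlane :=
    (differentiableOn_csqrt_comp differentiableOn_id fun _ h => h).mul (differentiableOn_cbfExt σ)
  refine AnalyticOnNhd.eqOn_of_preconnected_of_frequently_eq (z₀ := 1)
    ((differentiableOn_cbfExt τ).analyticOnNhd Complex.isOpen_slitPlane)
    (hd.analyticOnNhd Complex.isOpen_slitPlane)
    (Complex.starConvex_one_slitPlane.isPathConnected
      Complex.one_mem_slitPlane).isConnected.isPreconnected
    Complex.one_mem_slitPlane ?_ hz
  have ht : Tendsto (fun x : ℝ => (x : ℂ)) (𝓝[>] 1) (𝓝[≠] 1) := by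
    refine tendsto_nhdsWithin_iff.2 ⟨?_, ?_⟩
    · exact ((Complex.continuous_ofReal.tendsto 1).mono_left nhdsWithin_le_nhds)
    · filter_upwards [self_mem_nhdsWithin] with x hx
      have hx' : 1 < x := hx
      simpa using hx'.ne'
  refine ht.frequently (Eventually.frequently ?_)
  filter_upwards [self_mem_nhdsWithin] with x hx
  exact h x (one_pos.trans hx)

/-- The extension of `√x h` lies in the cone of `1` and `z`. Dividing by `√z` puts that of `h` in
the cone of `1/√z` and `√z`, so its real part is non-negative; its imaginary part is too, hence `Im
h² = 2 Re h Im h ≥ 0`. -/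
theorem IsCBF.sq {h : ℝ → ℝ} (hh : IsCBF h) (hf : IsCBF fun x => x ^ (1 / 2 : ℝ) * h x) :
    IsCBF fun x => h x ^ 2 := by
  obtain ⟨M, hM0, hM⟩ := hh.exists_le_max
  obtain ⟨N, hN0, hN⟩ := hf.exists_le_max
  have hnn := fun x (hx : 0 < x) => hh.nonneg hx
  obtain ⟨σ, hσ⟩ := hh
  obtain ⟨τ, hτ⟩ := hf
  have hp := isPick_cbfExt σ
  have hστ : ∀ x : ℝ, 0 < x → cbfExt τ x = csqrt x * cbfExt σ x := fun x hx => by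
    rw [cbfExt_ofReal, cbfExt_ofReal, ← hσ x hx, ← hτ x hx, csqrt_ofReal hx.le, Complex.ofReal_mul]
  have hP : IsPick fun z => cbfExt σ z ^ 2 := by
    refine ⟨hp.differentiableOn.pow 2, fun z hz => by rw [hp.map_conj z hz, map_pow],
      fun z hz => ?_, fun κ h0 h1 => ?_, ?_⟩
    · have hzs : z ∈ Complex.slitPlane := Complex.mem_slitPlane_iff.2 (Or.inr hz.ne')
      have hz0 : csqrt z ≠ 0 := fun h0 => by
        have := csqrt_mul_self z
        rw [h0, zero_mul] at this
        rw [← this] at hz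
        simp at hz
      have him := hp.im_nonneg z hz
      have hre : 0 ≤ (cbfExt σ z).re := by
        let L : ℂ →L[ℝ] ℝ := Complex.reCLM.comp
          ((ContinuousLinearMap.mul ℝ ℂ) (csqrt z)⁻¹)
        have hL : ∀ y, L y = ((csqrt z)⁻¹ * y).re := fun y => rfl
        have := cbfExt_mem_cone τ hzs L
          (by
            rw [hL, mul_one, Complex.inv_re]
            exact div_nonneg (csqrt_re_nonneg _) (Complex.normSq_nonneg _))
          (by
            have e : (csqrt z)⁻¹ * z = csqrt z := by
              nth_rw 2 [← csqrt_mul_self z]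
              rw [inv_mul_cancel_left₀ hz0]
            rw [hL, e]
            exact csqrt_re_nonneg _)
        rwa [hL, cbfExt_eq_csqrt_mul hστ hzs, inv_mul_cancel_left₀ hz0] at this
      rw [pow_two, Complex.mul_im]
      positivity
    · refine ⟨((√((1 - κ) / 2))⁻¹) ^ 2 * (M ^ 2 + N ^ 2), by positivity, fun z hz => ?_⟩
      have hz0 : 0 < ‖z‖ := norm_pos_iff.2 hz.1
      have h2 := norm_cbfExt_le σ h0 h1 hz
      rw [← hσ _ hz0] at h2
      rw [norm_pow]
      refine (pow_le_pow_left₀ (norm_nonneg _) h2 2).trans ?_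
      rw [mul_pow, mul_assoc]
      refine mul_le_mul_of_nonneg_left ?_ (by positivity)
      have h3 := hnn _ hz0
      -- The square of a linear bound on `h` would be quadratic. For `‖z‖ ≥ 1` the bound `√‖z‖ h ≤ N
      -- ‖z‖` gives `h² ≤ N² ‖z‖` instead.
      rcases le_total ‖z‖ 1 with hle | hge
      · have := hM _ hz0
        rw [max_eq_left hle, mul_one] at this
        nlinarith [pow_le_pow_left₀ h3 this 2, sq_nonneg N,
          mul_nonneg (add_nonneg (sq_nonneg M) (sq_nonneg N)) hz0.le]
      · have := hN _ hz0
        rw [max_eq_right hge] at this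
        have h4 := pow_le_pow_left₀ (by positivity) this 2
        rw [mul_pow, ← Real.sqrt_eq_rpow, Real.sq_sqrt hz0.le, mul_pow, pow_two ‖z‖] at h4
        have h5 : h ‖z‖ ^ 2 ≤ N ^ 2 * ‖z‖ := by
          refine le_of_mul_le_mul_left ?_ hz0
          linarith
        nlinarith [sq_nonneg M, sq_nonneg N, mul_nonneg (sq_nonneg M) hz0.le]
    · obtain ⟨b, hb0, hb⟩ := hp.tendsto
      refine ⟨b ^ 2, by positivity, fun κ h0 h1 => ?_⟩
      push_cast
      exact (hb κ h0 h1).pow 2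
  refine hP.isCBF.congr fun x hx => ?_
  rw [cbfExt_ofReal, ← hσ x hx, ← Complex.ofReal_pow, Complex.ofReal_re]

/-! ### Laplace transforms of superpositions of exponentials -/

theorem integrableOn_exp_neg_mul {x : ℝ} (hx : 0 < x) :
    IntegrableOn (fun t : ℝ => Real.exp (-(x * t))) (Ioi 0) := by
  simpa [neg_mul] using exp_neg_integrableOn_Ioi 0 hx

theorem setIntegral_exp_neg_mul {x : ℝ} (hx : 0 < x) :
    ∫ t in Ioi (0 : ℝ), Real.exp (-(x * t)) = 1 / x := by
  have := integral_exp_mul_Ioi (a := -x) (by linarith) 0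
  simp only [neg_mul] at this
  rw [this]; simp

section Fubini

variable {Ω : Type*} [MeasurableSpace Ω] {μ : Measure Ω} [SFinite μ] {w X : Ω → ℝ}

/-- Only `w / (x + X)` is assumed integrable, not `w`: for the density built from a representing
measure the weight `(1 - u)⁻¹` may have infinite integral. -/
theorem integrable_laplace_prod (hw : AEStronglyMeasurable w μ) (hw0 : 0 ≤ᵐ[μ] w)
    (hX : Measurable X) (hX0 : 0 ≤ᵐ[μ] X) {x : ℝ} (hx : 0 < x)
    (h : Integrable (fun a => w a / (x + X a)) μ) :
    Integrable (Function.uncurry fun (t : ℝ) a =>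
      Real.exp (-(x * t)) * (w a * Real.exp (-(t * X a)))) ((volume.restrict (Ioi 0)).prod μ) := by
  have hmeas : AEStronglyMeasurable (Function.uncurry fun (t : ℝ) a =>
      Real.exp (-(x * t)) * (w a * Real.exp (-(t * X a))))
      ((volume.restrict (Ioi (0 : ℝ))).prod μ) := by
    have h1 : Measurable fun p : ℝ × Ω => Real.exp (-(x * p.1)) := by fun_prop
    have h2 : Measurable fun p : ℝ × Ω => Real.exp (-(p.1 * X p.2)) := by fun_prop
    exact h1.aestronglyMeasurable.mul
      ((hw.comp_snd (μ := volume.restrict (Ioi (0 : ℝ)))).mul h2.aestronglyMeasurable)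
  have heq : ∀ a t, Real.exp (-(x * t)) * (w a * Real.exp (-(t * X a))) =
      w a * Real.exp (-((x + X a) * t)) := fun a t => by
    have : Real.exp (-((x + X a) * t)) = Real.exp (-(x * t)) * Real.exp (-(t * X a)) := by
      rw [← Real.exp_add]; congr 1; ring
    rw [this]; ring
  rw [integrable_prod_iff' hmeas]
  refine ⟨?_, h.congr ?_⟩
  · filter_upwards [hX0] with a ha
    have ha' : 0 ≤ X a := ha
    simp only [Function.uncurry_apply_pair, heq]
    exact (integrableOn_exp_neg_mul (by positivity)).const_mul _
  · filter_upwards [hX0, hw0] with a ha hwa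
    have ha' : 0 ≤ X a := ha
    have hwa' : 0 ≤ w a := hwa
    simp only [Function.uncurry_apply_pair, heq, norm_mul, Real.norm_eq_abs, Real.abs_exp,
      abs_of_nonneg hwa']
    rw [integral_const_mul, setIntegral_exp_neg_mul (by positivity), mul_one_div]

theorem integrableOn_laplace (hw : AEStronglyMeasurable w μ) (hw0 : 0 ≤ᵐ[μ] w)
    (hX : Measurable X) (hX0 : 0 ≤ᵐ[μ] X) {x : ℝ} (hx : 0 < x)
    (h : Integrable (fun a => w a / (x + X a)) μ) :
    IntegrableOn (fun t : ℝ => Real.exp (-(x * t)) * ∫ a, w a * Real.exp (-(t * X a)) ∂μ)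
      (Ioi 0) := by
  have := (integrable_laplace_prod hw hw0 hX hX0 hx h).integral_prod_left
  simp only [Function.uncurry_apply_pair, integral_const_mul] at this
  exact this

theorem setIntegral_laplace (hw : AEStronglyMeasurable w μ) (hw0 : 0 ≤ᵐ[μ] w)
    (hX : Measurable X) (hX0 : 0 ≤ᵐ[μ] X) {x : ℝ} (hx : 0 < x)
    (h : Integrable (fun a => w a / (x + X a)) μ) :
    ∫ t in Ioi (0 : ℝ), Real.exp (-(x * t)) * ∫ a, w a * Real.exp (-(t * X a)) ∂μ =
      ∫ a, w a / (x + X a) ∂μ := by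
  have := integral_integral_swap (integrable_laplace_prod hw hw0 hX hX0 hx h)
  simp only [integral_const_mul] at this
  rw [this]
  refine integral_congr_ae ?_
  filter_upwards [hX0] with a ha
  have ha' : 0 ≤ X a := ha
  have heq : ∀ t, Real.exp (-(x * t)) * (w a * Real.exp (-(t * X a))) =
      w a * Real.exp (-((x + X a) * t)) := fun t => by
    have : Real.exp (-((x + X a) * t)) = Real.exp (-(x * t)) * Real.exp (-(t * X a)) := by
      rw [← Real.exp_add]; congr 1; ring
    rw [this]; ring
  simp only [heq]
  rw [integral_const_mul, setIntegral_exp_neg_mul (by positivity), mul_one_div]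

end Fubini

/-- The functions `A` on `]0,∞[` whose Laplace transform converges on `]0,∞[` and is, after
multiplication by `x`, a superposition of the kernels in `IsCBF`. -/
structure IsLaplaceCBF (A : ℝ → ℝ) : Prop where
  integrableOn : ∀ x : ℝ, 0 < x → IntegrableOn (fun t => Real.exp (-(x * t)) * A t) (Ioi 0)
  isCBF : IsCBF fun x => x * ∫ t in Ioi (0 : ℝ), Real.exp (-(x * t)) * A t

theorem IsLaplaceCBF.add {A B : ℝ → ℝ} (hA : IsLaplaceCBF A) (hB : IsLaplaceCBF B) :
    IsLaplaceCBF fun t => A t + B t where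
  integrableOn x hx := by
    simp only [mul_add]
    exact (hA.integrableOn x hx).add (hB.integrableOn x hx)
  isCBF := (hA.isCBF.add hB.isCBF).congr fun x hx => by
    rw [← mul_add, ← integral_add (hA.integrableOn x hx) (hB.integrableOn x hx)]
    simp only [mul_add]

theorem IsLaplaceCBF.of_tendsto {F : ℕ → ℝ → ℝ} {A B : ℝ → ℝ} (hF : ∀ n, IsLaplaceCBF (F n))
    (hB : ∀ x : ℝ, 0 < x → IntegrableOn (fun t => Real.exp (-(x * t)) * B t) (Ioi 0))
    (hFB : ∀ n t, 0 < t → |F n t| ≤ B t)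
    (h : ∀ t : ℝ, 0 < t → Tendsto (fun n => F n t) atTop (𝓝 (A t))) : IsLaplaceCBF A := by
  have hlim : ∀ x : ℝ, ∀ᵐ t ∂volume.restrict (Ioi (0 : ℝ)),
      Tendsto (fun n => Real.exp (-(x * t)) * F n t) atTop (𝓝 (Real.exp (-(x * t)) * A t)) := by
    intro x
    filter_upwards [ae_restrict_mem measurableSet_Ioi] with t ht
    exact (h t ht).const_mul _
  have hle : ∀ x : ℝ, ∀ n, ∀ᵐ t ∂volume.restrict (Ioi (0 : ℝ)),
      ‖Real.exp (-(x * t)) * F n t‖ ≤ Real.exp (-(x * t)) * B t := by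
    intro x n
    filter_upwards [ae_restrict_mem measurableSet_Ioi] with t ht
    rw [norm_mul, Real.norm_eq_abs, Real.abs_exp, Real.norm_eq_abs]
    exact mul_le_mul_of_nonneg_left (hFB n t ht) (Real.exp_pos _).le
  refine ⟨fun x hx => ?_, ?_⟩
  · refine Integrable.mono' (hB x hx)
      (aestronglyMeasurable_of_tendsto_ae atTop (fun n => ((hF n).integrableOn x hx).1) (hlim x)) ?_
    filter_upwards [ae_restrict_mem measurableSet_Ioi] with t ht
    rw [norm_mul, Real.norm_eq_abs, Real.abs_exp, Real.norm_eq_abs]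
    exact mul_le_mul_of_nonneg_left
      (le_of_tendsto ((h t ht).abs) (Eventually.of_forall fun n => hFB n t ht)) (Real.exp_pos _).le
  · refine IsCBF.of_tendsto (l := atTop) (Eventually.of_forall fun n => (hF n).isCBF)
      fun x hx => Tendsto.const_mul _ ?_
    exact tendsto_integral_of_dominated_convergence _ (fun n => ((hF n).integrableOn x hx).1)
      (hB x hx) (hle x) (hlim x)

theorem isLaplaceCBF_integral {Ω : Type*} [MeasurableSpace Ω] {μ : Measure Ω} [SFinite μ]
    {w X : Ω → ℝ} (hw : Integrable w μ) (hw0 : 0 ≤ᵐ[μ] w) (hX : Measurable X)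
    (hX0 : 0 ≤ᵐ[μ] X) : IsLaplaceCBF fun t => ∫ a, w a * Real.exp (-(t * X a)) ∂μ := by
  have h : ∀ x : ℝ, 0 < x → Integrable (fun a => w a / (x + X a)) μ := fun x hx => by
    refine Integrable.mono' (hw.norm.const_mul x⁻¹)
      (hw.1.aemeasurable.div (by fun_prop)).aestronglyMeasurable ?_
    filter_upwards [hX0] with a ha
    have ha' : 0 ≤ X a := ha
    rw [norm_div, Real.norm_of_nonneg (by positivity : 0 ≤ x + X a), inv_mul_eq_div]
    gcongr
    linarith
  refine ⟨fun x hx => integrableOn_laplace hw.1 hw0 hX hX0 hx (h x hx),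
    (isCBF_integral hw hw0 hX hX0).congr fun x hx => ?_⟩
  rw [setIntegral_laplace hw.1 hw0 hX hX0 hx (h x hx), ← integral_const_mul]
  refine integral_congr_ae (ae_of_all _ fun a => ?_)
  simp only
  ring

theorem isLaplaceCBF_const_mul_exp {c l : ℝ} (hc : 0 ≤ c) (hl : 0 ≤ l) :
    IsLaplaceCBF fun t => c * Real.exp (-(t * l)) := by
  have := isLaplaceCBF_integral (μ := Measure.dirac ()) (w := fun _ => c) (X := fun _ => l)
    (integrable_const c) (ae_of_all _ fun _ => hc) measurable_const (ae_of_all _ fun _ => hl)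
  simpa using this

theorem isLaplaceCBF_sum (s : Finset ℕ) {c l : ℕ → ℝ} (hc : ∀ k, 0 ≤ c k) (hl : ∀ k, 0 ≤ l k) :
    IsLaplaceCBF fun t => ∑ k ∈ s, c k * Real.exp (-(t * l k)) := by
  classical
  induction s using Finset.induction_on with
  | empty => simpa using isLaplaceCBF_const_mul_exp le_rfl le_rfl
  | insert a s ha ih =>
    simp only [Finset.sum_insert ha]
    exact (isLaplaceCBF_const_mul_exp (hc a) (hl a)).add ih

/-- Laplace transforms of positive measures are completely monotonic. -/
theorem isCompletelyMonotonic_integral {Ω : Type*} [MeasurableSpace Ω] {μ : Measure Ω}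
    {w X : Ω → ℝ} (hw : Measurable w) (hw0 : ∀ a, 0 ≤ w a) (hX0 : ∀ a, 0 ≤ X a)
    (h : ∀ t : ℝ, 0 < t → Integrable (fun a => w a * Real.exp (-(t * X a))) μ) :
    IsCompletelyMonotonic fun t => ∫ a, w a * Real.exp (-(t * X a)) ∂μ := by
  set ν : Measure Ω := μ.withDensity fun a => ENNReal.ofReal (w a) with hν
  have hwm : Measurable fun a => ENNReal.ofReal (w a) := hw.ennreal_ofReal
  have hlt : ∀ᵐ a ∂μ, ENNReal.ofReal (w a) < ⊤ := ae_of_all _ fun a => ENNReal.ofReal_lt_top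
  -- With the weight absorbed into the measure this is the moment generating function of `-X`, whose
  -- `n`-th derivative inserts the factor `(-X)^n`.
  have e : (fun t => ∫ a, w a * Real.exp (-(t * X a)) ∂μ) =
      ProbabilityTheory.mgf (fun a => -X a) ν := by
    ext t
    rw [ProbabilityTheory.mgf, hν, integral_withDensity_eq_integral_toReal_smul hwm hlt]
    refine integral_congr_ae (ae_of_all _ fun a => ?_)
    simp [ENNReal.toReal_ofReal (hw0 a)]
  have hsub : Ioi (0 : ℝ) ⊆ interior (ProbabilityTheory.integrableExpSet (fun a => -X a) ν) := by
    refine interior_maximal (fun t ht => ?_) isOpen_Ioi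
    change Integrable _ ν
    rw [hν, integrable_withDensity_iff_integrable_smul' hwm hlt]
    refine (h t ht).congr (ae_of_all _ fun a => ?_)
    simp [ENNReal.toReal_ofReal (hw0 a)]
  rw [e]
  refine ⟨?_, fun n x hx => ?_⟩
  · exact (ProbabilityTheory.analyticOn_mgf.mono hsub).contDiffOn (uniqueDiffOn_Ioi 0)
  · rw [iteratedDerivWithin_of_isOpen isOpen_Ioi hx, ProbabilityTheory.iteratedDeriv_mgf (hsub hx),
      ← integral_const_mul]
    refine integral_nonneg fun a => ?_
    rw [← mul_assoc, ← mul_pow]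
    have := hX0 a
    simp only [neg_mul_neg, one_mul, Pi.zero_apply]
    positivity

theorem IsCompletelyMonotonic.congr {f g : ℝ → ℝ} (hf : IsCompletelyMonotonic f)
    (h : ∀ x, 0 < x → g x = f x) : IsCompletelyMonotonic g := by
  refine ⟨hf.1.congr h, fun n x hx => ?_⟩
  rw [iteratedDerivWithin_congr (s := Ioi 0) (f := g) (g := f) (fun y hy => h y hy) hx]
  exact hf.2 n x hx

/-! ### Completely monotonic functions as limits of superpositions of exponentials -/

theorem one_sub_pow_le_exp {y : ℝ} (h1 : y ≤ 1) (k : ℕ) :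
    (1 - y) ^ k ≤ Real.exp (-(k * y)) := by
  have : Real.exp (-(k * y)) = Real.exp (-y) ^ k := by rw [← Real.exp_nat_mul]; ring_nf
  rw [this]
  exact pow_le_pow_left₀ (by linarith) (by linarith [Real.add_one_le_exp (-y)]) k

/-- Multiply `e^{-y}(1 + y) ≤ 1` by `1 - y`, take `k`-th powers, and apply Bernoulli's inequality to
`(1 - y²)^k`. -/
theorem exp_sub_one_sub_pow_le {y : ℝ} (h0 : 0 ≤ y) (h1 : y ≤ 1) (k : ℕ) :
    Real.exp (-(k * y)) - (1 - y) ^ k ≤ k * y ^ 2 * Real.exp (-(k * y)) := by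
  have e : Real.exp (-(k * y)) = Real.exp (-y) ^ k := by rw [← Real.exp_nat_mul]; ring_nf
  have h2 : Real.exp (-y) * (1 - y ^ 2) ≤ 1 - y := by
    have h3 : Real.exp (-y) * (1 + y) ≤ 1 := by
      have := mul_le_mul_of_nonneg_left (Real.add_one_le_exp y) (Real.exp_pos (-y)).le
      rw [← Real.exp_add, neg_add_cancel, Real.exp_zero] at this
      linarith
    nlinarith
  have h4 : (Real.exp (-y) * (1 - y ^ 2)) ^ k ≤ (1 - y) ^ k :=
    pow_le_pow_left₀ (mul_nonneg (Real.exp_pos _).le (by nlinarith)) h2 k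
  have h5 : 1 + (k : ℝ) * (-y ^ 2) ≤ (1 + (-y ^ 2)) ^ k := one_add_mul_le_pow (by nlinarith) k
  rw [mul_pow] at h4
  rw [e]
  have h6 : 0 < Real.exp (-y) ^ k := by positivity
  have h7 : Real.exp (-y) ^ k * (1 + (k : ℝ) * (-y ^ 2)) ≤ Real.exp (-y) ^ k * (1 - y ^ 2) ^ k := by
    refine mul_le_mul_of_nonneg_left ?_ h6.le
    rwa [sub_eq_add_neg]
  nlinarith

/-- Put `v = ny`. The bound `v²e^{-v} ≤ 2` gives the rate uniformly in `y ≤ 1`; for `y ≥ 1` the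
power vanishes and `v ≥ n`. -/
theorem exp_neg_sub_max_pow_le {y : ℝ} (h0 : 0 ≤ y) {n : ℕ} (hn : 0 < n) :
    Real.exp (-(n * y)) - (max 0 (1 - y)) ^ n ≤ 2 / n := by
  have hn' : (0 : ℝ) < n := by exact_mod_cast hn
  have h1n : (1 : ℝ) ≤ n := by exact_mod_cast hn
  have hv : 0 ≤ (n : ℝ) * y := by positivity
  have hq := Real.quadratic_le_exp_of_nonneg hv
  have he : Real.exp (n * y) * Real.exp (-(n * y)) = 1 := by rw [← Real.exp_add]; simp
  have hep := Real.exp_pos (-(n * y))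
  rw [le_div_iff₀ hn']
  rcases le_total y 1 with h1 | h1
  · rw [max_eq_right (by linarith)]
    have h2 := exp_sub_one_sub_pow_le h0 h1 n
    have h3 : (n * y) ^ 2 * Real.exp (-(n * y)) ≤ 2 := by
      have := mul_le_mul_of_nonneg_right hq hep.le
      rw [he] at this
      nlinarith
    nlinarith
  · rw [max_eq_left (by linarith), zero_pow hn.ne', sub_zero]
    have := mul_le_mul_of_nonneg_right hq hep.le
    rw [he] at this
    have h3 : (n : ℝ) ≤ n * y := by nlinarith
    nlinarith

theorem max_pow_le_exp {y : ℝ} {n : ℕ} (hn : 0 < n) :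
    (max 0 (1 - y)) ^ n ≤ Real.exp (-(n * y)) := by
  rcases le_total y 1 with h1 | h1
  · rw [max_eq_right (by linarith)]
    exact one_sub_pow_le_exp h1 n
  · rw [max_eq_left (by linarith), zero_pow hn.ne']
    exact (Real.exp_pos _).le

/-- The non-negative functions `(-1)^k φ^{(k)}` attached to a completely monotonic function. -/
noncomputable def cmDeriv (φ : ℝ → ℝ) (k : ℕ) (s : ℝ) : ℝ := (-1) ^ k * iteratedDeriv k φ s

section

variable {φ : ℝ → ℝ}

theorem IsCompletelyMonotonic.cmDeriv_nonneg (h : IsCompletelyMonotonic φ) (k : ℕ) {s : ℝ}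
    (hs : 0 < s) : 0 ≤ cmDeriv φ k s := by
  have := h.2 k s hs
  rwa [iteratedDerivWithin_of_isOpen isOpen_Ioi hs] at this

theorem IsCompletelyMonotonic.nonneg (h : IsCompletelyMonotonic φ) {s : ℝ} (hs : 0 < s) :
    0 ≤ φ s := by
  simpa [cmDeriv] using h.cmDeriv_nonneg 0 hs

theorem IsCompletelyMonotonic.continuousOn_cmDeriv (h : IsCompletelyMonotonic φ) (k : ℕ) :
    ContinuousOn (cmDeriv φ k) (Ioi 0) := by
  refine continuousOn_const.mul ?_
  refine (h.1.continuousOn_iteratedDerivWithin (m := k) (by exact_mod_cast le_top)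
    (uniqueDiffOn_Ioi 0)).congr fun s hs => ?_
  rw [iteratedDerivWithin_of_isOpen isOpen_Ioi hs]

theorem IsCompletelyMonotonic.continuousOn (h : IsCompletelyMonotonic φ) :
    ContinuousOn φ (Ioi 0) := h.1.continuousOn

theorem IsCompletelyMonotonic.antitoneOn (h : IsCompletelyMonotonic φ) :
    AntitoneOn φ (Ioi 0) := by
  refine antitoneOn_of_deriv_nonpos (convex_Ioi 0) h.continuousOn ?_ fun s hs => ?_
  · rw [interior_Ioi]
    exact h.1.differentiableOn (by simp)
  · rw [interior_Ioi] at hs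
    have := h.cmDeriv_nonneg 1 hs
    simp [cmDeriv, iteratedDeriv_one] at this
    exact this

/-- Expanding backwards, from `b` down to `a`, makes the alternating signs cancel: every term and
the remainder are non-negative. -/
theorem IsCompletelyMonotonic.taylor (h : IsCompletelyMonotonic φ) {a b : ℝ} (ha : 0 < a)
    (hab : a < b) (n : ℕ) :
    φ a = ∑ k ∈ Finset.range (n + 1), cmDeriv φ k b * (b - a) ^ k / k.factorial +
      ∫ s in a..b, (s - a) ^ n / n.factorial * cmDeriv φ (n + 1) s := by
  have hsub : uIcc b a ⊆ Ioi 0 := by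
    rw [uIcc_of_ge hab.le]; exact fun s hs => ha.trans_le hs.1
  have hu : UniqueDiffOn ℝ (uIcc b a) := uniqueDiffOn_uIcc hab.ne'
  have hd : ∀ k : ℕ, ∀ s ∈ uIcc b a, iteratedDerivWithin k φ (uIcc b a) s = iteratedDeriv k φ s := by
    intro k s hs
    refine iteratedDerivWithin_eq_iteratedDeriv hu ?_ hs
    exact (h.1.contDiffAt (Ioi_mem_nhds (hsub hs))).of_le (by exact_mod_cast le_top)
  have ht := taylor_integral_remainder (n := n) ((h.1.mono hsub).of_le (by exact_mod_cast le_top))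
  rw [taylor_within_apply, intervalIntegral.integral_symm, sub_eq_iff_eq_add'] at ht
  rw [ht]
  congr 1
  · refine Finset.sum_congr rfl fun k _ => ?_
    rw [hd k b left_mem_uIcc, smul_eq_mul, cmDeriv, ← neg_sub b a, neg_pow]
    field_simp
  · rw [← intervalIntegral.integral_neg]
    refine intervalIntegral.integral_congr fun s hs => ?_
    rw [hd (n + 1) s (by rwa [uIcc_comm]), smul_eq_mul, cmDeriv, ← neg_sub s a, neg_pow, pow_succ]
    ring

/-- The coefficients of the discrete part of `bernsteinApprox`. -/
noncomputable def bernsteinCoeff (φ : ℝ → ℝ) (ε : ℝ) (n k : ℕ) : ℝ :=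
  cmDeriv φ k (ε + n) * (n : ℝ) ^ k / k.factorial

/-- The density of the continuous part of `bernsteinApprox`. -/
noncomputable def bernsteinWeight (φ : ℝ → ℝ) (ε : ℝ) (n : ℕ) (s : ℝ) : ℝ :=
  (s - ε) ^ n / n.factorial * cmDeriv φ (n + 1) s

/-- Superpositions of exponentials that approximate `t ↦ φ (ε + t)`. -/
noncomputable def bernsteinApprox (φ : ℝ → ℝ) (ε : ℝ) (n : ℕ) (t : ℝ) : ℝ :=
  ∑ k ∈ Finset.range (n + 1), bernsteinCoeff φ ε n k * Real.exp (-(t * (k / n))) +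
    ∫ s in Ioc ε (ε + n), bernsteinWeight φ ε n s * Real.exp (-(t * (n / (s - ε))))

variable {ε : ℝ} {n : ℕ}

theorem IsCompletelyMonotonic.bernsteinCoeff_nonneg (h : IsCompletelyMonotonic φ) (hε : 0 < ε)
    (n k : ℕ) : 0 ≤ bernsteinCoeff φ ε n k := by
  have := h.cmDeriv_nonneg k (show 0 < ε + n by positivity)
  unfold bernsteinCoeff
  positivity

theorem IsCompletelyMonotonic.bernsteinWeight_nonneg (h : IsCompletelyMonotonic φ) (hε : 0 < ε)
    {s : ℝ} (hs : ε < s) : 0 ≤ bernsteinWeight φ ε n s := by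
  have := h.cmDeriv_nonneg (n + 1) (hε.trans hs)
  have : 0 < s - ε := sub_pos.2 hs
  unfold bernsteinWeight
  positivity

theorem IsCompletelyMonotonic.integrableOn_bernsteinWeight (h : IsCompletelyMonotonic φ)
    (hε : 0 < ε) : IntegrableOn (bernsteinWeight φ ε n) (Ioc ε (ε + n)) := by
  have : ContinuousOn (bernsteinWeight φ ε n) (Icc ε (ε + n)) := by
    refine ContinuousOn.mul (by fun_prop) ((h.continuousOn_cmDeriv _).mono fun s hs => ?_)
    exact hε.trans_le hs.1
  exact this.integrableOn_Icc.mono_set Ioc_subset_Icc_self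

theorem IsCompletelyMonotonic.isLaplaceCBF_bernsteinApprox (h : IsCompletelyMonotonic φ)
    (hε : 0 < ε) (n : ℕ) : IsLaplaceCBF (bernsteinApprox φ ε n) := by
  refine (isLaplaceCBF_sum _ (h.bernsteinCoeff_nonneg hε n) fun k => by positivity).add
    (isLaplaceCBF_integral (h.integrableOn_bernsteinWeight hε) ?_ (by fun_prop) ?_)
  · filter_upwards [ae_restrict_mem measurableSet_Ioc] with s hs
    exact h.bernsteinWeight_nonneg hε hs.1
  · filter_upwards [ae_restrict_mem measurableSet_Ioc] with s hs
    exact div_nonneg (Nat.cast_nonneg n) (sub_nonneg.2 hs.1.le)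

/-- Taylor's formula of order `n` about `ε + n`, with `n(1 - t/n)` and `(s - ε)(1 - t/(s - ε))`
factored out. The weights no longer depend on `t`, the positive part extends the integral down to
`ε`, and each power is close to an exponential. -/
theorem IsCompletelyMonotonic.eq_sum_add_integral (h : IsCompletelyMonotonic φ) (hε : 0 < ε)
    (hn : 0 < n) {t : ℝ} (ht : 0 ≤ t) (htn : t < n) :
    φ (ε + t) = ∑ k ∈ Finset.range (n + 1), bernsteinCoeff φ ε n k * (1 - t / n) ^ k +
      ∫ s in Ioc ε (ε + n), bernsteinWeight φ ε n s * (max 0 (1 - t / (s - ε))) ^ n := by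
  have hn' : (0 : ℝ) < n := by exact_mod_cast hn
  rw [h.taylor (show 0 < ε + t by positivity) (show ε + t < ε + n by linarith) n]
  congr 1
  · refine Finset.sum_congr rfl fun k _ => ?_
    have : ε + n - (ε + t) = n * (1 - t / n) := by field_simp; ring
    rw [this, bernsteinCoeff, mul_pow]
    ring
  · rw [intervalIntegral.integral_of_le (by linarith)]
    have hsub : Ioc (ε + t) (ε + n) ⊆ Ioc ε (ε + n) := Ioc_subset_Ioc_left (by linarith)
    refine Eq.trans ?_ (setIntegral_eq_of_subset_of_forall_sdiff_eq_zero measurableSet_Ioc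
      hsub ?_).symm
    · refine setIntegral_congr_fun measurableSet_Ioc fun s hs => ?_
      have hs0 : 0 < s - ε := by linarith [hs.1]
      have h1 : t / (s - ε) ≤ 1 := by rw [div_le_one hs0]; linarith [hs.1]
      rw [max_eq_right (by linarith), bernsteinWeight]
      have : s - (ε + t) = (s - ε) * (1 - t / (s - ε)) := by field_simp; ring
      rw [this, mul_pow]
      ring
    · intro s hs
      have hs0 : 0 < s - ε := by linarith [hs.1.1]
      have hst : s ≤ ε + t := by
        by_contra hc
        exact hs.2 ⟨not_le.1 hc, hs.1.2⟩
      have h1 : 1 ≤ t / (s - ε) := by rw [one_le_div hs0]; linarith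
      rw [max_eq_left (by linarith), zero_pow hn.ne', mul_zero]

theorem IsCompletelyMonotonic.eq_sum_add_integral_zero (h : IsCompletelyMonotonic φ) (hε : 0 < ε)
    (hn : 0 < n) : φ ε = ∑ k ∈ Finset.range (n + 1), bernsteinCoeff φ ε n k +
      ∫ s in Ioc ε (ε + n), bernsteinWeight φ ε n s := by
  simpa using h.eq_sum_add_integral hε hn le_rfl (by exact_mod_cast hn)

theorem IsCompletelyMonotonic.integrableOn_bernsteinWeight_mul (h : IsCompletelyMonotonic φ)
    (hε : 0 < ε) {q : ℝ → ℝ} (hq : Measurable q) (hq1 : ∀ s ∈ Ioc ε (ε + n), |q s| ≤ 1) :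
    IntegrableOn (fun s => bernsteinWeight φ ε n s * q s) (Ioc ε (ε + n)) := by
  refine (h.integrableOn_bernsteinWeight hε).mul_bdd (c := 1) hq.aestronglyMeasurable ?_
  filter_upwards [ae_restrict_mem measurableSet_Ioc] with s hs using hq1 s hs

theorem abs_exp_neg_div_le {t : ℝ} (ht : 0 ≤ t) {s : ℝ} (hs : s ∈ Ioc ε (ε + n)) :
    |Real.exp (-(t * (n / (s - ε))))| ≤ 1 := by
  have : 0 < s - ε := sub_pos.2 hs.1
  rw [Real.abs_exp, Real.exp_le_one_iff, neg_nonpos]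
  positivity

theorem abs_max_pow_le {t : ℝ} (ht : 0 ≤ t) {s : ℝ} (hs : s ∈ Ioc ε (ε + n)) :
    |(max 0 (1 - t / (s - ε))) ^ n| ≤ 1 := by
  have : 0 < s - ε := sub_pos.2 hs.1
  have h0 : 0 ≤ t / (s - ε) := by positivity
  rw [abs_of_nonneg (by positivity)]
  exact pow_le_one₀ (le_max_left _ _) (max_le (by norm_num) (by linarith))

theorem IsCompletelyMonotonic.abs_bernsteinApprox_le (h : IsCompletelyMonotonic φ) (hε : 0 < ε)
    (hn : 0 < n) {t : ℝ} (ht : 0 ≤ t) : |bernsteinApprox φ ε n t| ≤ φ ε := by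
  have hnn : ∀ k, 0 ≤ bernsteinCoeff φ ε n k := h.bernsteinCoeff_nonneg hε n
  have hw : ∀ s ∈ Ioc ε (ε + n), 0 ≤ bernsteinWeight φ ε n s := fun s hs =>
    h.bernsteinWeight_nonneg hε hs.1
  rw [abs_of_nonneg, h.eq_sum_add_integral_zero hε hn]
  · refine add_le_add (Finset.sum_le_sum fun k _ => ?_) ?_
    · refine mul_le_of_le_one_right (hnn k) ?_
      rw [Real.exp_le_one_iff, neg_nonpos]
      positivity
    · refine setIntegral_mono_on (h.integrableOn_bernsteinWeight_mul hε (by fun_prop)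
        fun s hs => abs_exp_neg_div_le ht hs) (h.integrableOn_bernsteinWeight hε)
        measurableSet_Ioc fun s hs => ?_
      exact mul_le_of_le_one_right (hw s hs) ((le_abs_self _).trans (abs_exp_neg_div_le ht hs))
  · refine add_nonneg (Finset.sum_nonneg fun k _ => mul_nonneg (hnn k) (Real.exp_pos _).le) ?_
    exact setIntegral_nonneg measurableSet_Ioc fun s hs => mul_nonneg (hw s hs) (Real.exp_pos _).le

/-- Each power differs from its exponential by at most `(t² + 2)/n`, and the total weight, read off
at `t = 0`, is `φ ε`. -/
theorem IsCompletelyMonotonic.abs_bernsteinApprox_sub_le (h : IsCompletelyMonotonic φ)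
    (hε : 0 < ε) (hn : 0 < n) {t : ℝ} (ht : 0 ≤ t) (htn : t < n) :
    |bernsteinApprox φ ε n t - φ (ε + t)| ≤ (t ^ 2 + 2) / n * φ ε := by
  have hn' : (0 : ℝ) < n := by exact_mod_cast hn
  have hnn : ∀ k, 0 ≤ bernsteinCoeff φ ε n k := h.bernsteinCoeff_nonneg hε n
  have hw : ∀ s ∈ Ioc ε (ε + n), 0 ≤ bernsteinWeight φ ε n s := fun s hs =>
    h.bernsteinWeight_nonneg hε hs.1
  have ht1 : t / n ≤ 1 := by rw [div_le_one hn']; exact htn.le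
  have ht0 : 0 ≤ t / n := by positivity
  have hi1 := h.integrableOn_bernsteinWeight_mul (n := n) hε
    (q := fun s => Real.exp (-(t * (n / (s - ε))))) (by fun_prop)
    fun s hs => abs_exp_neg_div_le ht hs
  have hi2 := h.integrableOn_bernsteinWeight_mul (n := n) hε
    (q := fun s => (max 0 (1 - t / (s - ε))) ^ n) (by fun_prop)
    fun s hs => abs_max_pow_le ht hs
  have e : bernsteinApprox φ ε n t - φ (ε + t) =
      ∑ k ∈ Finset.range (n + 1), bernsteinCoeff φ ε n k *
        (Real.exp (-(k * (t / n))) - (1 - t / n) ^ k) +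
      ∫ s in Ioc ε (ε + n), bernsteinWeight φ ε n s *
        (Real.exp (-(n * (t / (s - ε)))) - (max 0 (1 - t / (s - ε))) ^ n) := by
    rw [h.eq_sum_add_integral hε hn ht htn, bernsteinApprox, add_sub_add_comm,
      ← Finset.sum_sub_distrib, ← integral_sub hi1 hi2]
    congr 1
    · refine Finset.sum_congr rfl fun k _ => ?_
      rw [← mul_sub]; congr 4; ring
    · refine integral_congr_ae (ae_of_all _ fun s => ?_)
      simp only
      rw [← mul_sub]; congr 4; ring
  have hint : IntegrableOn (fun s => bernsteinWeight φ ε n s *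
      (Real.exp (-(n * (t / (s - ε)))) - (max 0 (1 - t / (s - ε))) ^ n)) (Ioc ε (ε + n)) := by
    refine (hi1.sub hi2).congr (ae_of_all _ fun s => ?_)
    simp only [Pi.sub_apply]
    rw [← mul_sub]; congr 4; ring
  rw [e, abs_of_nonneg]
  · rw [h.eq_sum_add_integral_zero hε hn, mul_add, Finset.mul_sum, ← integral_const_mul]
    refine add_le_add (Finset.sum_le_sum fun k hk => ?_) ?_
    · rw [mul_comm]
      refine mul_le_mul_of_nonneg_right ?_ (hnn k)
      refine (exp_sub_one_sub_pow_le ht0 ht1 k).trans ?_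
      have hk' : (k : ℝ) ≤ n := by
        exact_mod_cast Nat.lt_succ_iff.1 (Finset.mem_range.1 hk)
      have h1 : Real.exp (-(k * (t / n))) ≤ 1 := by
        rw [Real.exp_le_one_iff, neg_nonpos]; positivity
      calc (k : ℝ) * (t / n) ^ 2 * Real.exp (-(k * (t / n))) ≤ n * (t / n) ^ 2 * 1 := by gcongr
        _ = t ^ 2 / n := by field_simp
        _ ≤ (t ^ 2 + 2) / n := by gcongr; linarith
    · refine setIntegral_mono_on hint ((h.integrableOn_bernsteinWeight hε).const_mul _)
        measurableSet_Ioc fun s hs => ?_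
      rw [mul_comm]
      refine mul_le_mul_of_nonneg_right ?_ (hw s hs)
      refine (exp_neg_sub_max_pow_le (div_nonneg ht (sub_pos.2 hs.1).le) hn).trans ?_
      gcongr
      nlinarith
  · refine add_nonneg (Finset.sum_nonneg fun k _ => mul_nonneg (hnn k)
      (sub_nonneg.2 (one_sub_pow_le_exp ht1 k))) ?_
    exact setIntegral_nonneg measurableSet_Ioc fun s hs => mul_nonneg (hw s hs)
      (sub_nonneg.2 (max_pow_le_exp hn))

/-- This replaces Bernstein's theorem: no measure is built for `φ`, only the property of the
transform passes to the limit. The shift by `ε` makes the constant `φ ε` a dominating function. -/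
theorem IsCompletelyMonotonic.isLaplaceCBF_shift (h : IsCompletelyMonotonic φ) (hε : 0 < ε) :
    IsLaplaceCBF fun t => φ (ε + t) := by
  refine IsLaplaceCBF.of_tendsto (F := fun n => bernsteinApprox φ ε (n + 1)) (B := fun _ => φ ε)
    (fun n => h.isLaplaceCBF_bernsteinApprox hε _)
    (fun x hx => (integrableOn_exp_neg_mul hx).mul_const _)
    (fun n t ht => h.abs_bernsteinApprox_le hε n.succ_pos ht.le) fun t ht => ?_
  rw [tendsto_iff_norm_sub_tendsto_zero]
  have hlim : Tendsto (fun n : ℕ => (t ^ 2 + 2) / ((n + 1 : ℕ) : ℝ) * φ ε) atTop (𝓝 0) := by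
    have := (((tendsto_const_div_atTop_nhds_zero_nat (t ^ 2 + 2)).comp
      (tendsto_add_atTop_nat 1)).mul_const (φ ε))
    simpa using this
  refine squeeze_zero' (Eventually.of_forall fun n => norm_nonneg _) ?_ hlim
  filter_upwards [tendsto_natCast_atTop_atTop.eventually_gt_atTop t] with n hn
  exact h.abs_bernsteinApprox_sub_le hε n.succ_pos ht.le (by push_cast; linarith)

theorem IsLICM.integrableOn_exp_mul (h : IsLICM φ) {x : ℝ} (hx : 0 < x) :
    IntegrableOn (fun t => Real.exp (-(x * t)) * φ t) (Ioi 0) := by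
  rw [← Ioc_union_Ioi_eq_Ioi zero_le_one]
  refine IntegrableOn.union ?_ ?_
  · have h1 : IntegrableOn φ (Ioc 0 1) := h.2.mono_set Ioc_subset_Icc_self
    refine h1.bdd_mul (c := 1) (by fun_prop) ?_
    filter_upwards [ae_restrict_mem measurableSet_Ioc] with t ht
    rw [Real.norm_eq_abs, Real.abs_exp, Real.exp_le_one_iff, neg_nonpos]
    exact mul_nonneg hx.le ht.1.le
  · refine Integrable.mono' (((integrableOn_exp_neg_mul hx).mono_set
      (Ioi_subset_Ioi zero_le_one)).mul_const (φ 1)) ?_ ?_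
    · refine ContinuousOn.aestronglyMeasurable ?_ measurableSet_Ioi
      exact ContinuousOn.mul (by fun_prop) (h.1.continuousOn.mono (Ioi_subset_Ioi zero_le_one))
    · filter_upwards [ae_restrict_mem measurableSet_Ioi] with t ht
      have ht0 : (0 : ℝ) < t := one_pos.trans ht
      rw [norm_mul, Real.norm_eq_abs, Real.abs_exp, Real.norm_of_nonneg (h.1.nonneg ht0)]
      exact mul_le_mul_of_nonneg_left (h.1.antitoneOn (mem_Ioi.2 one_pos) ht0 (le_of_lt ht))
        (Real.exp_pos _).le

theorem IsLICM.isLaplaceCBF (h : IsLICM φ) : IsLaplaceCBF φ := by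
  have hpos : ∀ n : ℕ, (0 : ℝ) < 1 / ((n : ℝ) + 1) := fun n => by positivity
  refine IsLaplaceCBF.of_tendsto (F := fun (n : ℕ) t => φ (1 / ((n : ℝ) + 1) + t)) (B := φ)
    (fun n => h.1.isLaplaceCBF_shift (hpos n)) (fun x hx => h.integrableOn_exp_mul hx)
    (fun n t ht => ?_) fun t ht => ?_
  · have h1 : (0 : ℝ) < 1 / ((n : ℝ) + 1) + t := by positivity
    rw [abs_of_nonneg (h.1.nonneg h1)]
    exact h.1.antitoneOn (mem_Ioi.2 ht) (mem_Ioi.2 h1) (by linarith [hpos n])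
  · have hc : ContinuousAt φ t := h.1.continuousOn.continuousAt (Ioi_mem_nhds ht)
    refine hc.tendsto.comp ?_
    simpa using (tendsto_one_div_add_atTop_nhds_zero_nat (𝕜 := ℝ)).add_const t

end

/-! ### From complete Bernstein functions to representing measures -/

theorem extendHalfLine_coe (f : ℝ≥0 → ℝ) (x : ℝ≥0) : extendHalfLine f x = f x := by
  simp [extendHalfLine]

theorem continuous_extendHalfLine {f : ℝ≥0 → ℝ} (hf : Continuous f) :
    Continuous (extendHalfLine f) := hf.comp continuous_real_toNNReal

theorem exists_le_affine_of_mem_bernsteinClass {g : ℝ≥0 → ℝ} (hg : g ∈ bernsteinClass) :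
    ∃ M N : ℝ, 0 ≤ M ∧ 0 ≤ N ∧ ∀ t : ℝ, 0 < t → extendHalfLine g t ≤ M + N * t := by
  obtain ⟨hc, h0, hd, hcm⟩ := hg
  have hcont := continuous_extendHalfLine hc
  have hN := hcm.1.nonneg one_pos
  refine ⟨extendHalfLine g 1, deriv (extendHalfLine g) 1, h0 _, hN, fun t ht => ?_⟩
  rcases le_total t 1 with h1 | h1
  · have hmono : MonotoneOn (extendHalfLine g) (Ici 0) := by
      refine monotoneOn_of_deriv_nonneg (convex_Ici 0) hcont.continuousOn ?_ fun s hs => ?_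
      · rw [interior_Ici]
        exact fun s hs => (hd s hs).differentiableWithinAt
      · rw [interior_Ici] at hs
        exact hcm.1.nonneg hs
    have := hmono (mem_Ici.2 ht.le) (mem_Ici.2 zero_le_one) h1
    have := mul_nonneg hN ht.le
    linarith
  · have := Convex.image_sub_le_mul_sub_of_deriv_le (convex_Ici (1 : ℝ)) (f := extendHalfLine g)
      (C := deriv (extendHalfLine g) 1) hcont.continuousOn
      (by
        rw [interior_Ici]
        exact fun s hs => (hd s (one_pos.trans hs)).differentiableWithinAt)
      (by
        rw [interior_Ici]
        exact fun s hs => hcm.1.antitoneOn (mem_Ioi.2 one_pos)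
          (mem_Ioi.2 (one_pos.trans hs)) (le_of_lt hs)) 1 (mem_Ici.2 le_rfl) t h1 h1
    linarith

theorem exp_neg_mul_affine_le {x : ℝ} (hx : 0 < x) {M N : ℝ} (hM : 0 ≤ M) (hN : 0 ≤ N) {t : ℝ}
    (ht : 0 < t) : Real.exp (-(x * t)) * (M + N * t) ≤
      (M + N * (2 / x)) * Real.exp (-(x / 2 * t)) := by
  have e : Real.exp (-(x * t)) = Real.exp (-(x / 2 * t)) * Real.exp (-(x / 2 * t)) := by
    rw [← Real.exp_add]; congr 1; ring
  have hp := Real.exp_pos (-(x / 2 * t))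
  have h1 : Real.exp (-(x / 2 * t)) ≤ 1 := by
    rw [Real.exp_le_one_iff, neg_nonpos]; positivity
  have h2 : t * Real.exp (-(x / 2 * t)) ≤ 2 / x := by
    have h3 := mul_le_mul_of_nonneg_right (Real.add_one_le_exp (x / 2 * t)) hp.le
    rw [← Real.exp_add, add_neg_cancel, Real.exp_zero] at h3
    rw [le_div_iff₀ hx]
    nlinarith
  rw [e, mul_assoc, mul_comm]
  refine mul_le_mul_of_nonneg_right ?_ hp.le
  have h4 := mul_le_mul_of_nonneg_left h2 hN
  have h5 := mul_le_of_le_one_left hM h1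
  linarith

/-- Integration by parts; at most linear growth of `g` kills the boundary term at infinity. -/
theorem sq_mul_laplaceTransform {g : ℝ≥0 → ℝ} (hg : g ∈ bernsteinClass) {x : ℝ} (hx : 0 < x) :
    x ^ 2 * laplaceTransform g x = x * g 0 +
      x * ∫ t in Ioi (0 : ℝ), Real.exp (-(x * t)) * deriv (extendHalfLine g) t := by
  obtain ⟨M, N, hM, hN, hb⟩ := exists_le_affine_of_mem_bernsteinClass hg
  obtain ⟨hc, h0, hd, hcm⟩ := hg
  have hcont := continuous_extendHalfLine hc
  set K := M + N * (2 / x) with hK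
  have hbound : ∀ t : ℝ, 0 < t → ‖Real.exp (-(x * t)) * extendHalfLine g t‖ ≤
      K * Real.exp (-(x / 2 * t)) := fun t ht => by
    rw [norm_mul, Real.norm_eq_abs, Real.abs_exp,
      Real.norm_of_nonneg (show 0 ≤ extendHalfLine g t from h0 _)]
    exact (mul_le_mul_of_nonneg_left (hb t ht) (Real.exp_pos _).le).trans
      (exp_neg_mul_affine_le hx hM hN ht)
  have hint : IntegrableOn (fun t => Real.exp (-(x * t)) * extendHalfLine g t) (Ioi 0) := by
    refine Integrable.mono' ((integrableOn_exp_neg_mul (half_pos hx)).const_mul K)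
      (Continuous.aestronglyMeasurable (by fun_prop)) ?_
    filter_upwards [ae_restrict_mem measurableSet_Ioi] with t ht using hbound t ht
  have hkey := integral_Ioi_mul_deriv_eq_deriv_mul (a := 0) (a' := g 0) (b' := 0)
    (u := fun t => Real.exp (-(x * t))) (u' := fun t => -x * Real.exp (-(x * t)))
    (v := extendHalfLine g) (v' := deriv (extendHalfLine g))
    (fun t _ => by
      have := ((hasDerivAt_id t).const_mul x).neg.exp
      refine this.congr_deriv ?_
      simp; ring)
    (fun t ht => (hd t ht).hasDerivAt) (hcm.integrableOn_exp_mul hx)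
    (by
      refine (hint.const_mul (-x)).congr (ae_of_all _ fun t => ?_)
      simp only [Pi.mul_apply]; ring)
    (by
      have hct : Continuous ((fun t => Real.exp (-(x * t))) * extendHalfLine g) :=
        Continuous.mul (by fun_prop) hcont
      have := hct.tendsto 0
      simp [extendHalfLine] at this
      exact this.mono_left nhdsWithin_le_nhds)
    (by
      have ht : Tendsto (fun t : ℝ => K * Real.exp (-(x / 2 * t))) atTop (𝓝 0) := by
        have := (Real.tendsto_exp_neg_atTop_nhds_zero.comp
          (tendsto_id.const_mul_atTop (half_pos hx))).const_mul K
        simpa using this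
      refine squeeze_zero_norm' ?_ ht
      filter_upwards [eventually_gt_atTop 0] with t ht using hbound t ht)
  rw [hkey, laplaceTransform]
  simp only [mul_assoc, integral_const_mul]
  ring

theorem isCBF_of_mem_completeBernsteinClass {f : ℝ≥0 → ℝ} (hf : f ∈ completeBernsteinClass) :
    IsCBF (extendHalfLine f) := by
  obtain ⟨-, g, hg, h⟩ := hf
  refine ((isCBF_const_mul_id (hg.2.1 0)).add hg.2.2.2.isLaplaceCBF.isCBF).congr fun x hx => ?_
  have := h x.toNNReal (by simpa using hx)
  rw [Real.coe_toNNReal x hx.le, sq_mul_laplaceTransform hg hx] at this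
  rw [extendHalfLine, this]
  ring

/-! ### From representing measures to Bernstein functions -/

section Density

variable (σ : FiniteMeasure unitInterval)

/-- The derivative of the Bernstein function whose Laplace transform is represented by `σ`. -/
noncomputable def cbfDensity (t : ℝ) : ℝ :=
  ∫ u : unitInterval, (1 - (u : ℝ))⁻¹ * Real.exp (-(t * ((u : ℝ) * (1 - (u : ℝ))⁻¹)))
    ∂(σ : Measure unitInterval)

theorem cbfWeight_nonneg (u : unitInterval) : 0 ≤ (1 - (u : ℝ))⁻¹ :=
  inv_nonneg.2 (sub_nonneg.2 u.2.2)

theorem cbfExponent_nonneg (u : unitInterval) : 0 ≤ (u : ℝ) * (1 - (u : ℝ))⁻¹ :=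
  mul_nonneg u.2.1 (cbfWeight_nonneg u)

/-- At `u = 1` the convention `0⁻¹ = 0` makes the left side vanish while the kernel equals `x`; the
indicator removes this atom, which later returns as the initial value of `cbfPrimitive`. -/
theorem cbfWeight_div {x : ℝ} (hx : 0 < x) (u : unitInterval) :
    x * ((1 - (u : ℝ))⁻¹ / (x + (u : ℝ) * (1 - (u : ℝ))⁻¹)) =
      x / ((1 - (u : ℝ)) * x + u) - Set.indicator {1} (fun _ => x) u := by
  by_cases h : u = 1
  · simp [h]
  · have h1 : 1 - (u : ℝ) ≠ 0 := fun h0 => h (Subtype.ext (sub_eq_zero.1 h0).symm)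
    have h2 := (cbfKernel_denom_pos u hx).ne'
    rw [indicator_of_notMem (by simpa using h), sub_zero]
    have e : x + (u : ℝ) * (1 - (u : ℝ))⁻¹ = ((1 - (u : ℝ)) * x + u) * (1 - (u : ℝ))⁻¹ := by
      field_simp
    rw [e, mul_div_assoc', mul_div_mul_right _ _ (inv_ne_zero h1)]

theorem integrable_cbfWeight_div {x : ℝ} (hx : 0 < x) :
    Integrable (fun u : unitInterval => (1 - (u : ℝ))⁻¹ / (x + (u : ℝ) * (1 - (u : ℝ))⁻¹))
      (σ : Measure unitInterval) := by
  have h : Integrable (fun u : unitInterval => x⁻¹ * (x / ((1 - (u : ℝ)) * x + u) -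
      Set.indicator {1} (fun _ => x) u)) (σ : Measure unitInterval) :=
    ((integrable_cbfKernel σ hx).sub
      ((integrable_const x).indicator (measurableSet_singleton _))).const_mul _
  refine h.congr (ae_of_all _ fun u => ?_)
  simp only
  rw [← cbfWeight_div hx, inv_mul_cancel_left₀ hx.ne']

/-- Since `e^{-tX} ≤ 1 / (1 + tX) = t⁻¹ / (t⁻¹ + X)`, integrability follows from that of the
resolvent at `x = t⁻¹`. -/
theorem integrable_cbfWeight_exp {t : ℝ} (ht : 0 < t) :
    Integrable (fun u : unitInterval => (1 - (u : ℝ))⁻¹ *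
      Real.exp (-(t * ((u : ℝ) * (1 - (u : ℝ))⁻¹)))) (σ : Measure unitInterval) := by
  have h := (integrable_cbfWeight_div σ (inv_pos.2 ht)).const_mul t⁻¹
  refine Integrable.mono' h (Measurable.aestronglyMeasurable (by fun_prop))
    (ae_of_all _ fun u => ?_)
  have h0 := cbfWeight_nonneg u
  have h1 := cbfExponent_nonneg u
  rw [norm_mul, Real.norm_of_nonneg h0, Real.norm_eq_abs, Real.abs_exp, mul_div_assoc',
    mul_comm t⁻¹, mul_div_assoc]
  refine mul_le_mul_of_nonneg_left ?_ h0
  rw [Real.exp_neg, inv_eq_one_div, div_le_div_iff₀ (Real.exp_pos _) (by positivity)]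
  have h2 := mul_le_mul_of_nonneg_left (Real.add_one_le_exp (t * ((u : ℝ) * (1 - (u : ℝ))⁻¹)))
    (inv_pos.2 ht).le
  have h3 : t⁻¹ * (t * ((u : ℝ) * (1 - (u : ℝ))⁻¹) + 1) = t⁻¹ + (u : ℝ) * (1 - (u : ℝ))⁻¹ := by
    field_simp
    ring
  rw [h3] at h2
  linarith

theorem isCompletelyMonotonic_cbfDensity : IsCompletelyMonotonic (cbfDensity σ) :=
  isCompletelyMonotonic_integral (by fun_prop) cbfWeight_nonneg cbfExponent_nonneg
    fun _ ht => integrable_cbfWeight_exp σ ht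

theorem integrableOn_exp_mul_cbfDensity {x : ℝ} (hx : 0 < x) :
    IntegrableOn (fun t : ℝ => Real.exp (-(x * t)) * cbfDensity σ t) (Ioi 0) :=
  integrableOn_laplace (Measurable.aestronglyMeasurable (by fun_prop))
    (ae_of_all _ cbfWeight_nonneg) (by fun_prop) (ae_of_all _ cbfExponent_nonneg) hx
    (integrable_cbfWeight_div σ hx)

theorem mul_setIntegral_cbfDensity {x : ℝ} (hx : 0 < x) :
    x * ∫ t in Ioi (0 : ℝ), Real.exp (-(x * t)) * cbfDensity σ t =
      (∫ u : unitInterval, x / ((1 - (u : ℝ)) * x + u) ∂(σ : Measure unitInterval)) -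
        x * (σ : Measure unitInterval).real {1} := by
  unfold cbfDensity
  rw [setIntegral_laplace (Measurable.aestronglyMeasurable (by fun_prop))
    (ae_of_all _ cbfWeight_nonneg) (by fun_prop) (ae_of_all _ cbfExponent_nonneg) hx
    (integrable_cbfWeight_div σ hx), ← integral_const_mul]
  simp only [cbfWeight_div hx]
  rw [integral_sub (integrable_cbfKernel σ hx)
    ((integrable_const x).indicator (measurableSet_singleton _)),
    integral_indicator_const _ (measurableSet_singleton _), smul_eq_mul, mul_comm x]

/-- Local integrability up to `0` comes from the convergent Laplace integral at `x = 1`, multiplied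
by the locally bounded `e^t`. -/
theorem intervalIntegrable_indicator_cbfDensity (a b : ℝ) :
    IntervalIntegrable (indicator (Ioi 0) (cbfDensity σ)) volume a b := by
  have key : ∀ a b : ℝ, IntegrableOn (indicator (Ioi 0) (cbfDensity σ)) (Ioc a b) := by
    intro a b
    rw [IntegrableOn, integrable_indicator_iff measurableSet_Ioi, IntegrableOn,
      Measure.restrict_restrict measurableSet_Ioi]
    have h1 := (integrableOn_exp_mul_cbfDensity σ one_pos).mono_set
      (inter_subset_left : Ioi 0 ∩ Ioc a b ⊆ Ioi 0)
    have h2 : Integrable (fun t => Real.exp t * (Real.exp (-(1 * t)) * cbfDensity σ t))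
        (volume.restrict (Ioi 0 ∩ Ioc a b)) := by
      refine h1.bdd_mul (c := Real.exp b) (by fun_prop) ?_
      filter_upwards [ae_restrict_mem (measurableSet_Ioi.inter measurableSet_Ioc)] with t ht
      rw [Real.norm_eq_abs, Real.abs_exp]
      exact Real.exp_le_exp.2 ht.2.2
    refine h2.congr (ae_of_all _ fun t => ?_)
    simp only
    rw [← mul_assoc, ← Real.exp_add]
    simp
  exact ⟨key a b, key b a⟩

/-- The Bernstein function whose Laplace transform is represented by `σ`. -/
noncomputable def cbfPrimitive (t : ℝ≥0) : ℝ :=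
  (σ : Measure unitInterval).real {1} + ∫ s in (0 : ℝ)..t, indicator (Ioi 0) (cbfDensity σ) s

theorem hasDerivAt_cbfPrimitive {t : ℝ} (ht : 0 < t) :
    HasDerivAt (extendHalfLine (cbfPrimitive σ)) (cbfDensity σ t) t := by
  have hev : indicator (Ioi 0) (cbfDensity σ) =ᶠ[𝓝 t] cbfDensity σ := by
    filter_upwards [Ioi_mem_nhds ht] with s hs using indicator_of_mem hs _
  have hc : ContinuousAt (cbfDensity σ) t :=
    (isCompletelyMonotonic_cbfDensity σ).continuousOn.continuousAt (Ioi_mem_nhds ht)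
  have hc' : ContinuousAt (indicator (Ioi 0) (cbfDensity σ)) t := hc.congr hev.symm
  have h := (intervalIntegral.integral_hasDerivAt_right
    (intervalIntegrable_indicator_cbfDensity σ 0 t) ?_ hc').const_add
    ((σ : Measure unitInterval).real {1})
  · rw [hev.eq_of_nhds] at h
    refine h.congr_of_eventuallyEq ?_
    filter_upwards [Ioi_mem_nhds ht] with s hs
    have hs' : 0 < s := hs
    simp [extendHalfLine, cbfPrimitive, hs'.le]
  · refine ⟨Ioc (t - 1) (t + 1), Ioc_mem_nhds (by linarith) (by linarith), ?_⟩
    exact (intervalIntegrable_indicator_cbfDensity σ (t - 1) (t + 1)).1.1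

theorem cbfPrimitive_mem_bernsteinClass : cbfPrimitive σ ∈ bernsteinClass := by
  have hcm := isCompletelyMonotonic_cbfDensity σ
  have hd : ∀ t : ℝ, 0 < t → deriv (extendHalfLine (cbfPrimitive σ)) t = cbfDensity σ t :=
    fun t ht => (hasDerivAt_cbfPrimitive σ ht).deriv
  refine ⟨?_, fun t => ?_, fun t ht => (hasDerivAt_cbfPrimitive σ ht).differentiableAt,
    hcm.congr hd, ?_⟩
  · exact continuous_const.add ((intervalIntegral.continuous_primitive
      (intervalIntegrable_indicator_cbfDensity σ) 0).comp NNReal.continuous_coe)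
  · refine add_nonneg measureReal_nonneg (intervalIntegral.integral_nonneg t.2 fun s _ => ?_)
    exact indicator_nonneg (fun s hs => hcm.nonneg hs) s
  · rw [integrableOn_Icc_iff_integrableOn_Ioc]
    refine ((intervalIntegrable_indicator_cbfDensity σ 0 1).1).congr_fun (fun t ht => ?_)
      measurableSet_Ioc
    rw [hd t ht.1, indicator_of_mem (show t ∈ Ioi (0 : ℝ) from ht.1)]

end Density

theorem mem_completeBernsteinClass_of_isCBF {f : ℝ≥0 → ℝ} (hf : Continuous f)
    (h : IsCBF (extendHalfLine f)) : f ∈ completeBernsteinClass := by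
  obtain ⟨σ, hσ⟩ := h
  refine ⟨hf, cbfPrimitive σ, cbfPrimitive_mem_bernsteinClass σ, fun x hx => ?_⟩
  have hx' : (0 : ℝ) < x := hx
  rw [sq_mul_laplaceTransform (cbfPrimitive_mem_bernsteinClass σ) hx']
  have e : ∫ t in Ioi (0 : ℝ), Real.exp (-(x * t)) * deriv (extendHalfLine (cbfPrimitive σ)) t =
      ∫ t in Ioi (0 : ℝ), Real.exp (-(x * t)) * cbfDensity σ t :=
    setIntegral_congr_fun measurableSet_Ioi fun t ht => by
      simp only [(hasDerivAt_cbfPrimitive σ ht).deriv]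
  rw [e, mul_setIntegral_cbfDensity σ hx', ← hσ x hx', extendHalfLine_coe]
  simp [cbfPrimitive]

theorem mem_completeBernsteinClass_iff {f : ℝ≥0 → ℝ} :
    f ∈ completeBernsteinClass ↔ Continuous f ∧ IsCBF (extendHalfLine f) :=
  ⟨fun h => ⟨h.1, isCBF_of_mem_completeBernsteinClass h⟩,
    fun h => mem_completeBernsteinClass_of_isCBF h.1 h.2⟩

theorem nonneg_of_mem_completeBernsteinClass {f : ℝ≥0 → ℝ} (hf : f ∈ completeBernsteinClass)
    (x : ℝ≥0) : 0 ≤ f x := by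
  obtain ⟨hc, h⟩ := mem_completeBernsteinClass_iff.1 hf
  have hpos : ∀ y : ℝ≥0, 0 < y → 0 ≤ f y := fun y hy => by
    rw [← extendHalfLine_coe f y]; exact h.nonneg hy
  rcases eq_or_lt_of_le (show 0 ≤ x from bot_le) with h0 | h0
  · rw [← h0]
    have ht : Tendsto (fun n : ℕ => f (1 / ((n : ℝ≥0) + 1))) atTop (𝓝 (f 0)) :=
      (hc.tendsto 0).comp (tendsto_one_div_add_atTop_nhds_zero_nat (𝕜 := ℝ≥0))
    exact ge_of_tendsto' ht fun n => hpos _ (by positivity)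
  · exact hpos x h0

/-! ### Complete Bernstein functions are Bernstein functions -/

theorem setIntegral_mul_exp_neg_mul {D : ℝ} (hD : 0 < D) :
    ∫ v in Ioi (0 : ℝ), v * Real.exp (-(D * v)) = 1 / D ^ 2 := by
  have := Real.integral_rpow_mul_exp_neg_mul_Ioi (a := 2) (r := D) two_pos hD
  norm_num at this
  rw [one_div, ← this]

theorem integrableOn_mul_exp_neg_mul {D : ℝ} (hD : 0 < D) :
    IntegrableOn (fun v : ℝ => v * Real.exp (-(D * v))) (Ioi 0) := by
  -- A non-integrable function has Bochner integral `0`, but the value is positive.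
  by_contra h
  have := setIntegral_mul_exp_neg_mul hD
  rw [integral_undef h] at this
  have : 0 < 1 / D ^ 2 := by positivity
  linarith

theorem integrable_cbfKernel_deriv (σ : FiniteMeasure unitInterval) {x : ℝ} (hx : 0 < x) :
    Integrable (fun u : unitInterval => (u : ℝ) / ((1 - (u : ℝ)) * x + u) ^ 2)
      (σ : Measure unitInterval) := by
  have hc : Continuous fun u : unitInterval => (u : ℝ) / ((1 - (u : ℝ)) * x + u) ^ 2 :=
    Continuous.div (by fun_prop) (by fun_prop)
      fun u => pow_ne_zero _ (cbfKernel_denom_pos u hx).ne'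
  exact hc.integrable_of_hasCompactSupport (HasCompactSupport.of_compactSpace _)

section

variable (σ : FiniteMeasure unitInterval)

theorem cbfDeriv_integrand {x v : ℝ} (u : unitInterval) (hv : 0 < v) :
    max 0 ((u : ℝ) * v * Real.exp (-(u * v))) * Real.exp (-(x * max 0 ((1 - (u : ℝ)) * v))) =
      (u : ℝ) * (v * Real.exp (-(((1 - (u : ℝ)) * x + u) * v))) := by
  have h0 := u.2.1
  have h1 : 0 ≤ 1 - (u : ℝ) := sub_nonneg.2 u.2.2
  rw [max_eq_right (by positivity), max_eq_right (by positivity), mul_assoc, ← Real.exp_add,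
    mul_assoc]
  congr 3
  ring

theorem integrable_cbfDeriv_prod {x : ℝ} (hx : 0 < x) :
    Integrable (fun p : unitInterval × ℝ => max 0 ((p.1 : ℝ) * p.2 * Real.exp (-(p.1 * p.2))) *
      Real.exp (-(x * max 0 ((1 - (p.1 : ℝ)) * p.2))))
      ((σ : Measure unitInterval).prod (volume.restrict (Ioi (0 : ℝ)))) := by
  rw [integrable_prod_iff (Measurable.aestronglyMeasurable (by fun_prop))]
  have e : ∀ u : unitInterval, (fun v : ℝ => max 0 ((u : ℝ) * v * Real.exp (-(u * v))) *
      Real.exp (-(x * max 0 ((1 - (u : ℝ)) * v)))) =ᵐ[volume.restrict (Ioi 0)]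
      fun v => (u : ℝ) * (v * Real.exp (-(((1 - (u : ℝ)) * x + u) * v))) := fun u => by
    filter_upwards [ae_restrict_mem measurableSet_Ioi] with v hv
    rw [cbfDeriv_integrand u hv]
  refine ⟨ae_of_all _ fun u => ?_, ?_⟩
  · exact Integrable.congr
      ((integrableOn_mul_exp_neg_mul (cbfKernel_denom_pos u hx)).const_mul _) (e u).symm
  · refine (integrable_cbfKernel_deriv σ hx).congr (ae_of_all _ fun u => ?_)
    simp only
    have : ∀ v : ℝ, ‖max 0 ((u : ℝ) * v * Real.exp (-(u * v))) *
        Real.exp (-(x * max 0 ((1 - (u : ℝ)) * v)))‖ = max 0 ((u : ℝ) * v * Real.exp (-(u * v))) *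
        Real.exp (-(x * max 0 ((1 - (u : ℝ)) * v))) := fun v =>
      Real.norm_of_nonneg (mul_nonneg (le_max_left _ _) (Real.exp_pos _).le)
    simp only [this]
    rw [integral_congr_ae (e u), integral_const_mul,
      setIntegral_mul_exp_neg_mul (cbfKernel_denom_pos u hx), mul_one_div]

/-- The kernel `u / ((1 - u) x + u)²` is `∫ u v e^{-uv} e^{-x(1-u)v} dv` over `v > 0`, so the
function is the Laplace transform of a positive measure. The positive parts only ensure signs for `v
< 0`. -/
theorem isCompletelyMonotonic_cbfDeriv : IsCompletelyMonotonic fun x =>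
    ∫ u : unitInterval, (u : ℝ) / ((1 - (u : ℝ)) * x + u) ^ 2 ∂(σ : Measure unitInterval) := by
  refine (isCompletelyMonotonic_integral
    (μ := (σ : Measure unitInterval).prod (volume.restrict (Ioi (0 : ℝ))))
    (w := fun p => max 0 ((p.1 : ℝ) * p.2 * Real.exp (-(p.1 * p.2))))
    (X := fun p => max 0 ((1 - (p.1 : ℝ)) * p.2)) (by fun_prop) (fun p => le_max_left _ _)
    (fun p => le_max_left _ _) fun x hx => integrable_cbfDeriv_prod σ hx).congr fun x hx => ?_
  rw [integral_prod _ (integrable_cbfDeriv_prod σ hx)]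
  refine integral_congr_ae (ae_of_all _ fun u => ?_)
  simp only
  rw [setIntegral_congr_fun measurableSet_Ioi (g := fun v =>
    (u : ℝ) * (v * Real.exp (-(((1 - (u : ℝ)) * x + u) * v)))) fun v hv => ?_,
    integral_const_mul, setIntegral_mul_exp_neg_mul (cbfKernel_denom_pos u hx), mul_one_div]
  simp only
  rw [cbfDeriv_integrand u hv]

theorem hasDerivAt_cbf {x : ℝ} (hx : 0 < x) :
    HasDerivAt (fun x : ℝ => ∫ u : unitInterval, x / ((1 - (u : ℝ)) * x + u)
      ∂(σ : Measure unitInterval))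
      (∫ u : unitInterval, (u : ℝ) / ((1 - (u : ℝ)) * x + u) ^ 2 ∂(σ : Measure unitInterval)) x := by
  have h := (hasDerivAt_cbfExt σ (ofReal_mem_slitPlane hx)).real_of_complex
  simp only [cbfExt_ofReal, Complex.ofReal_re] at h
  refine h.congr_deriv ?_
  rw [← Complex.ofReal_re (∫ u : unitInterval, _ ∂_), ← integral_complex_ofReal]
  push_cast
  rfl

end

/-- Differentiating under the integral gives a completely monotonic derivative; it is integrable
near `0` because it is non-negative and its primitive `f` is continuous there. -/
theorem completeBernsteinClass_subset_bernsteinClass : completeBernsteinClass ⊆ bernsteinClass := by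
  intro f hf
  have h0 := nonneg_of_mem_completeBernsteinClass hf
  obtain ⟨hc, σ, hσ⟩ := mem_completeBernsteinClass_iff.1 hf
  have hcm := isCompletelyMonotonic_cbfDeriv σ
  have hd : ∀ x : ℝ, 0 < x → HasDerivAt (extendHalfLine f)
      (∫ u : unitInterval, (u : ℝ) / ((1 - (u : ℝ)) * x + u) ^ 2 ∂(σ : Measure unitInterval)) x :=
    fun x hx => (hasDerivAt_cbf σ hx).congr_of_eventuallyEq (by
      filter_upwards [Ioi_mem_nhds hx] with y hy using hσ y hy)
  have hcm' : IsCompletelyMonotonic (deriv (extendHalfLine f)) :=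
    hcm.congr fun x hx => (hd x hx).deriv
  refine ⟨hc, h0, fun x hx => (hd x hx).differentiableAt, hcm', ?_⟩
  rw [integrableOn_Icc_iff_integrableOn_Ioc]
  exact intervalIntegral.integrableOn_deriv_of_nonneg
    (continuous_extendHalfLine hc).continuousOn
    (fun x hx => (hd x hx.1).differentiableAt.hasDerivAt) fun x hx => hcm'.nonneg hx.1

/-! ### The identity of classes and the inclusion -/

theorem rpow_half_mem_completeBernsteinClass {f : ℝ≥0 → ℝ} (hf : f ∈ completeBernsteinClass) :
    (fun p => f p ^ (1 / 2 : ℝ)) ∈ completeBernsteinClass := by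
  obtain ⟨hc, h⟩ := mem_completeBernsteinClass_iff.1 hf
  exact mem_completeBernsteinClass_of_isCBF (hc.rpow_const fun _ => Or.inr (by norm_num)) h.sqrt

theorem rpow_half_mul_mem_completeBernsteinClass {f : ℝ≥0 → ℝ} (hf : f ∈ completeBernsteinClass) :
    (fun p : ℝ≥0 => (p : ℝ) ^ (1 / 2 : ℝ) * f p ^ (1 / 2 : ℝ)) ∈ completeBernsteinClass := by
  obtain ⟨hc, h⟩ := mem_completeBernsteinClass_iff.1 hf
  refine mem_completeBernsteinClass_of_isCBF ?_ (h.sqrt_mul.congr fun x hx => ?_)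
  · exact (NNReal.continuous_coe.rpow_const fun _ => Or.inr (by norm_num)).mul
      (hc.rpow_const fun _ => Or.inr (by norm_num))
  · simp [extendHalfLine, hx.le]

theorem sq_mem_completeBernsteinClass {f : ℝ≥0 → ℝ} (hf : f ∈ completeBernsteinClass)
    (hf' : (fun p : ℝ≥0 => (p : ℝ) ^ (1 / 2 : ℝ) * f p) ∈ completeBernsteinClass) :
    (fun p => f p ^ 2) ∈ completeBernsteinClass := by
  obtain ⟨hc, h⟩ := mem_completeBernsteinClass_iff.1 hf
  obtain ⟨-, h'⟩ := mem_completeBernsteinClass_iff.1 hf'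
  refine mem_completeBernsteinClass_of_isCBF (hc.pow 2) (h.sq (h'.congr fun x hx => ?_))
  simp [extendHalfLine, hx.le]

theorem completeBernsteinClass_inter_varPowMulClass :
    completeBernsteinClass ∩ varPowMulClass (1 / 2) completeBernsteinClass =
      varPowMulClass (1 / 2) (powClass completeBernsteinClass (1 / 2)) := by
  apply Subset.antisymm
  · rintro _ ⟨hf, h, hh, rfl⟩
    -- The witness under the root is `h²`; non-negativity of `h`, including at `0`, gives back `h`.
    refine ⟨h, ⟨_, sq_mem_completeBernsteinClass hh hf, funext fun p => ?_⟩, rfl⟩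
    simp only
    rw [← Real.sqrt_eq_rpow, Real.sqrt_sq (nonneg_of_mem_completeBernsteinClass hh p)]
  · rintro _ ⟨_, ⟨k, hk, rfl⟩, rfl⟩
    exact ⟨rpow_half_mul_mem_completeBernsteinClass hk, _,
      rpow_half_mem_completeBernsteinClass hk, rfl⟩

theorem mainTheorem4 :
    completeBernsteinClass ∩ varPowMulClass (1 / 2) completeBernsteinClass
        = varPowMulClass (1 / 2) (powClass completeBernsteinClass (1 / 2)) ∧
      waveNumberClassBernstein ⊆ waveNumberClassCrF := by
  refine ⟨completeBernsteinClass_inter_varPowMulClass, ?_⟩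
  rw [waveNumberClassBernstein, completeBernsteinClass_inter_varPowMulClass]
  exact image_mono (image_mono completeBernsteinClass_subset_bernsteinClass)
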